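/- **Theorem.** Let $n\ge 2$ and let $X\subset\mathbb R^n$ be a bounded, open, convex set with $C^1$ boundary and outward unit normal $\nu$; let $d\mu$ be the surface measure of $\partial X$, let $\Gamma_-=\{(x',v')\in\partial X\times\mathbb S^{n-1}: v'\cdot\nu(x')<0\}$ and $d\xi=|\nu(x')\cdot v'|\,d\mu(x')\,dv'$. Put $\tau_\pm(x,v)=\inf\{s>0: x\pm sv\notin X\}$. Let $\sigma\in\mathcal C_b(X\times\mathbb S^{n-1})$ and $k\in\mathcal C_b(X\times\mathbb S^{n-1}\times\mathbb S^{n-1})$ (bounded, continuous, real-valued), and define $$\sigma_a(x,v)=\sigma(x,v)-\int_{\mathbb S^{n-1}}k(x,v,w)\,dw,\qquad \chi(x,v',v)=\sigma_a(x,v)\,k(x,v',v),$$ $$E(x_0,x_1)=\exp\Big(-\int_0^{|x_0-x_1|}\sigma\big(x_0-s\hat\omega,\hat\omega\big)ds\Big),\quad \hat\omega=\tfrac{x_0-x_1}{|x_0-x_1|},\qquad E(x_0,x_1,x_2)=E(x_0,x_1)E(x_1,x_2).$$ Let $A_1$ be the single scattering part of the albedo operator, $A_1\phi(x)=\int_{\mathbb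 S^{n-1}}\sigma_a(x,v)u_1(x,v)\,dv$ for $\phi\in L^1(\Gamma_-,d\xi)$, where $$u_0(x,v)=e^{-\int_0^{\tau_-(x,v)}\sigma(x-pv,v)dp}\,\phi(x-\tau_-(x,v)v,v),$$ $$u_1(x,v)=\int_0^{\tau_-(x,v)}E(x,x-tv)\int_{\mathbb S^{n-1}}k(x-tv,v',v)\,u_0(x-tv,v')\,dv'\,dt$$ are the solutions, by integration along characteristics, of $v\cdot\nabla_xu_0+\sigma u_0=0$ in $X\times\mathbb S^{n-1}$, $u_0=\phi$ on $\Gamma_-$, and of $v\cdot\nabla_xu_1+\sigma u_1=\int k(x,v',v)u_0(x,v')dv'$, $u_1=0$ on $\Gamma_-$. Then the following holds. (i) The Schwartz kernel of $A_1$ is the function $$\alpha_1(x,x',v')=|\nu(x')\cdot v'|\int_0^{\tau_+(x',v')}\sigma_a(x,v)\,\frac{E(x,x'+tv',x')}{|x-x'-tv'|^{n-1}}\,k(x'+tv',v',v)\Big|_{v=\frac{x-x'-tv'}{|x-x'-tv'|}}\,dt,$$ that is, for every $\phi\in L^1(\Gamma_-,d\xi)$ and almost every $x\in X$, the function $\alpha_1(x,\cdot,\cdot)\phi$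 is integrable on $\Gamma_-$ with respect to $d\mu\,dv'$ and $A_1\phi(x)=\int_{\Gamma_-}\alpha_1(x,x',v')\phi(x',v')\,d\mu(x')\,dv'$. (ii) Let $(x',v')\in\Gamma_-$, let $x=x'+t_0'v'$ with $t_0'\in(0,\tau_+(x',v'))$, and let $v'^\perp\in\mathbb S^{n-1}$ satisfy $v'\cdot v'^\perp=0$. Then, as $\varepsilon\to0^+$, for $n=2$, $$\frac{\alpha_1(x+\varepsilon v'^\perp,x',v')}{E(x,x')|\nu(x')\cdot v'|}=\Big(\ln\frac1\varepsilon\Big)\big(\chi(x,v',v')+\chi(x,v',-v')\big)+o\Big(\ln\frac1\varepsilon\Big),$$ and for $n\ge3$, with $v(\theta)=\cos\theta\,v'+\sin\theta\,v'^\perp$, $$\frac{\alpha_1(x+\varepsilon v'^\perp,x',v')}{E(x,x')|\nu(x')\cdot v'|}=\frac1{\varepsilon^{n-2}}\int_0^\pi\sin^{n-3}\theta\;\chi(x,v',v(\theta))\,d\theta+o\Big(\frac1{\varepsilon^{n-2}}\Big).$$ -/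

import Mathlib

open MeasureTheory Set Metric Filter Topology Asymptotics
open scoped RealInnerProductSpace

noncomputable section

namespace Photoacoustic

/-- The Euclidean space `ℝⁿ`. -/
abbrev Space (n : ℕ) : Type := EuclideanSpace ℝ (Fin n)

/-- The surface measure `dv` of the unit sphere `𝕊ⁿ⁻¹`, seen as a measure on `ℝⁿ`
(directions are vectors of `ℝⁿ` of norm one). -/
def sphereMeasure (n : ℕ) : Measure (Space n) :=
  ((volume : Measure (Space n)).toSphere).map Subtype.val

/-! ### Domains with a `C¹` boundary -/

/-- `w` is the outward unit normal to `X` at the point `x`, where near `x` the set `X` is the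
sublevel set `{ρ < 0}` of a `C¹` function `ρ` with `ρ x = 0` and `∇ρ(x) ≠ 0`. -/
def IsOutwardUnitNormal {n : ℕ} (X : Set (Space n)) (x w : Space n) : Prop :=
  ∃ (U : Set (Space n)) (ρ : Space n → ℝ), IsOpen U ∧ x ∈ U ∧ ContDiffOn ℝ 1 ρ U ∧
    (∀ y ∈ U, y ∈ X ↔ ρ y < 0) ∧ ρ x = 0 ∧ gradient ρ x ≠ 0 ∧
    w = ‖gradient ρ x‖⁻¹ • gradient ρ x

/-- `X` has a `C¹` boundary: every boundary point admits a local `C¹` defining function. -/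
def HasC1Boundary {n : ℕ} (X : Set (Space n)) : Prop :=
  ∀ x ∈ frontier X, ∃ w, IsOutwardUnitNormal X x w

open Classical in
/-- The outward unit normal `ν(x)` at a boundary point `x` (it does not depend on the defining
function; the value `0` is used where there is no normal). -/
def outwardNormal {n : ℕ} (X : Set (Space n)) (x : Space n) : Space n :=
  if h : ∃ w, IsOutwardUnitNormal X x w then h.choose else 0

/-- The incoming boundary `Γ₋ = {(x, v) ∈ ∂X × 𝕊ⁿ⁻¹ : v · ν(x) < 0}`. -/
def incoming {n : ℕ} (X : Set (Space n)) : Set (Space n × Space n) :=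
  {p | p.1 ∈ frontier X ∧ p.2 ∈ sphere (0 : Space n) 1 ∧ ⟪outwardNormal X p.1, p.2⟫ < 0}

/-- The measure `dμ(x) dv` on `Γ₋`, with `μ` the surface measure of `∂X`, i.e. the
`(n-1)`-dimensional Hausdorff measure normalised so as to agree with Lebesgue measure on
hyperplanes. -/
def incomingMeasure {n : ℕ} (X : Set (Space n)) : Measure (Space n × Space n) :=
  (((Measure.euclideanHausdorffMeasure (n - 1)).restrict (frontier X)).prod
    (sphereMeasure n)).restrict (incoming X)

/-- The measure `dξ = |v · ν(x)| dμ(x) dv` on `Γ₋`. -/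
def fluxMeasure {n : ℕ} (X : Set (Space n)) : Measure (Space n × Space n) :=
  (incomingMeasure X).withDensity fun p => ENNReal.ofReal |⟪outwardNormal X p.1, p.2⟫|

/-- `τ₊(x, v)`, the time of escape from `X` in the direction `v`, for `x ∈ X` or
`(x, v) ∈ Γ₋`. -/
def tauPlus {n : ℕ} (X : Set (Space n)) (x v : Space n) : ℝ :=
  sInf {s : ℝ | 0 < s ∧ x + s • v ∉ X}

/-- `τ₋(x, v)`, the time of escape from `X` in the direction `-v`. -/
def tauMinus {n : ℕ} (X : Set (Space n)) (x v : Space n) : ℝ :=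
  sInf {s : ℝ | 0 < s ∧ x - s • v ∉ X}

/-! ### Optical coefficients

`σ x v` is the total attenuation coefficient and `k x v' v` the scattering coefficient, with `v'`
the direction before and `v` the direction after the scattering event. -/

/-- `f` is a bounded continuous real function on `S`. -/
def BoundedContinuousOn {Y : Type*} [TopologicalSpace Y] (f : Y → ℝ) (S : Set Y) : Prop :=
  ContinuousOn f S ∧ ∃ M : ℝ, ∀ y ∈ S, |f y| ≤ M

/-- `σₛ(x, v) = ∫ k(x, v, v') dv'`. -/
def sigmaS {n : ℕ} (k : Space n → Space n → Space n → ℝ) (x v : Space n) : ℝ :=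
  ∫ v', k x v v' ∂(sphereMeasure n)

/-- The intrinsic attenuation `σₐ = σ - σₛ`. -/
def sigmaA {n : ℕ} (σ : Space n → Space n → ℝ) (k : Space n → Space n → Space n → ℝ)
    (x v : Space n) : ℝ :=
  σ x v - sigmaS k x v

/-- `χ(x, v', v) = σₐ(x, v) k(x, v', v)`. -/
def chi {n : ℕ} (σ : Space n → Space n → ℝ) (k : Space n → Space n → Space n → ℝ)
    (x v' v : Space n) : ℝ :=
  sigmaA σ k x v * k x v' v

/-- The unit vector `(x - y) / |x - y|`. -/
def direction {n : ℕ} (x y : Space n) : Space n := ‖x - y‖⁻¹ • (x - y)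

/-- The attenuation `E(x₀, x₁)` along the segment from `x₁` to `x₀`. -/
def attenuation {n : ℕ} (σ : Space n → Space n → ℝ) (x₀ x₁ : Space n) : ℝ :=
  Real.exp (-∫ s in (0 : ℝ)..‖x₀ - x₁‖, σ (x₀ - s • direction x₀ x₁) (direction x₀ x₁))

/-! ### The single scattering part of the albedo operator -/

/-- The ballistic part: the solution `u₀` of `v · ∇u₀ + σ u₀ = 0` in `X × 𝕊ⁿ⁻¹`, `u₀ = φ` on
`Γ₋`, obtained by integration along the characteristics. -/
def ballistic {n : ℕ} (X : Set (Space n)) (σ : Space n → Space n → ℝ)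
    (φ : Space n × Space n → ℝ) (x v : Space n) : ℝ :=
  Real.exp (-∫ p in (0 : ℝ)..tauMinus X x v, σ (x - p • v) v) * φ (x - tauMinus X x v • v, v)

/-- The solution `w` of `v · ∇w + σ w = ∫ k(x, v', v) u(x, v') dv'` in `X × 𝕊ⁿ⁻¹`, `w = 0` on
`Γ₋`, obtained by integration along the characteristics. -/
def scatter {n : ℕ} (X : Set (Space n)) (σ : Space n → Space n → ℝ)
    (k : Space n → Space n → Space n → ℝ) (u : Space n → Space n → ℝ) (x v : Space n) : ℝ :=
  ∫ t in (0 : ℝ)..tauMinus X x v, attenuation σ x (x - t • v) *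
    ∫ v', k (x - t • v) v' v * u (x - t • v) v' ∂(sphereMeasure n)

/-- The single scattering part `A₁` of the albedo operator: `A₁φ(x) = ∫ σₐ(x, v) u₁(x, v) dv`,
with `u₁` the part of the radiation that has scattered exactly once. -/
def albedoOne {n : ℕ} (X : Set (Space n)) (σ : Space n → Space n → ℝ)
    (k : Space n → Space n → Space n → ℝ) (φ : Space n × Space n → ℝ) (x : Space n) : ℝ :=
  ∫ v, sigmaA σ k x v * scatter X σ k (ballistic X σ φ) x v ∂(sphereMeasure n)

/-- `α(x, x', v')` is the Schwartz kernel of the operator `T` from `L¹(Γ₋, dξ)` to functions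
on `X`: `Tφ(x) = ∫_{Γ₋} α(x, x', v') φ(x', v') dμ(x') dv'` for almost every `x ∈ X`. -/
def IsSchwartzKernel {n : ℕ} (X : Set (Space n))
    (T : (Space n × Space n → ℝ) → Space n → ℝ) (α : Space n → Space n → Space n → ℝ) : Prop :=
  ∀ φ : Space n × Space n → ℝ, Integrable φ (fluxMeasure X) →
    ∀ᵐ x ∂(volume.restrict X),
      Integrable (fun p : Space n × Space n => α x p.1 p.2 * φ p) (incomingMeasure X) ∧
      T φ x = ∫ p, α x p.1 p.2 * φ p ∂(incomingMeasure X)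

/-- The function `α₁(x, x', v')`, defined at every point off the ray `x' + ℝ₊ v'`. -/
def alphaOne {n : ℕ} (X : Set (Space n)) (σ : Space n → Space n → ℝ)
    (k : Space n → Space n → Space n → ℝ) (x x' v' : Space n) : ℝ :=
  |⟪outwardNormal X x', v'⟫| * ∫ t in (0 : ℝ)..tauPlus X x' v',
    sigmaA σ k x (direction x (x' + t • v')) *
      (attenuation σ x (x' + t • v') * attenuation σ (x' + t • v') x' /
        ‖x - x' - t • v'‖ ^ (n - 1)) *
      k (x' + t • v') v' (direction x (x' + t • v'))

end Photoacoustic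

end

open Photoacoustic

/-! For (i), `albedoOne` is an integral over the final direction v, the distance t travelled since
the scattering event, and the direction v' before it. Polar coordinates y = x - tv about x turn (v,
t) into the scattering point y ∈ X at the price of a factor |x - y|^(1-n), so A₁φ(x) becomes one
integral over the phase space X × 𝕊ⁿ⁻¹ of pairs (y, v') (`albedoOne_eq_integral`). Each such pair
lies on exactly one ray issued from Γ₋, and in the coordinates y = x' + tv' the measure dy dv' is dt
dξ (`map_rayPoint`). On that ray u₀(y, v') = E(y, x') φ(x', v'), so integrating in t first leaves α₁
against φ.

The change of variables rests on the area formula for the projection of the incoming boundary along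
a direction, `setLIntegral_abs_inner_outwardNormal`. It is obtained without charts: near each point
the C¹ boundary is almost bi-Lipschitz to its tangent hyperplane, where the projection scales area
by |ν · v|, and the errors tend to 1. Absolute convergence for almost every x is Tonelli: |x -
y|^(1-n) is integrable in x over X uniformly in y ∈ X, and φ carried along the rays is integrable
because chords have bounded length.

For (ii), put w = v'^⊥ and s = t₀ - t. At x + εw the distance to the scattering point is √(s² + ε²),
so the normalised kernel is the integral over s of a(ε, s) / (s² + ε²)^((n-1)/2) with a bounded; as
s and ε tend to 0 with the direction of sv' + εw tending to d, a tends to χ(x, v', d)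
(`tendsto_nearRayDensity`). If n ≥ 3, the scale s ~ ε dominates: the substitution s = ε cot θ gives
ε^(2-n) ∫ sin^(n-3) θ a dθ with direction exactly v(θ), and dominated convergence applies. If n = 2,
all scales between ε and 1 count equally: the substitution s = ±ε^r extracts log(1/ε), each r in (0,
1) has limiting direction ±v', and the other r contribute nothing in the limit.

The coefficients matter only on X and at unit directions, so they may be replaced by bounded
measurable functions on the whole space. -/

namespace Photoacoustic

/-! ### Outward normals and chords of a convex C¹ domain -/

section ConvexGeometry

variable {n : ℕ} {X : Set (Space n)}

theorem IsOutwardUnitNormal.norm_eq_one {x w : Space n} (h : IsOutwardUnitNormal X x w) :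
    ‖w‖ = 1 := by
  obtain ⟨U, ρ, -, -, -, -, -, hne, rfl⟩ := h
  rw [norm_smul, norm_inv, norm_norm, inv_mul_cancel₀ (norm_ne_zero_iff.2 hne)]

/-- Near a point with an outward normal `w`, the set `X` lies behind: moving in a direction `u`
with `⟪w, u⟫ < 0` enters `X`, and if moving along `u` stays in `X` then `⟪w, u⟫ ≤ 0`. -/
theorem IsOutwardUnitNormal.eventually_mem {x w : Space n} (h : IsOutwardUnitNormal X x w)
    {u : Space n} (hu : ⟪w, u⟫ < 0) : ∀ᶠ t in 𝓝[>] (0 : ℝ), x + t • u ∈ X := by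
  obtain ⟨U, ρ, hU, hxU, hρ, hX, hρx, hne, rfl⟩ := h
  have hd : DifferentiableAt ℝ ρ x :=
    (hρ.differentiableOn (by norm_num)).differentiableAt (hU.mem_nhds hxU)
  have hline : HasDerivAt (fun t : ℝ => x + t • u) u 0 := by
    simpa using ((hasDerivAt_id (0 : ℝ)).smul_const u).const_add x
  have hg : HasDerivAt (fun t : ℝ => ρ (x + t • u)) ⟪gradient ρ x, u⟫ 0 := by
    have h1 := hd.hasGradientAt.hasFDerivAt
    have h2 : HasFDerivAt ρ ((InnerProductSpace.toDual ℝ (Space n)) (gradient ρ x))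
        (x + (0 : ℝ) • u) := by simpa using h1
    have h3 := h2.comp_hasDerivAt (0 : ℝ) hline
    rw [InnerProductSpace.toDual_apply_apply] at h3
    exact h3
  have hneg : ⟪gradient ρ x, u⟫ < 0 := by
    rw [real_inner_smul_left] at hu
    exact (pos_iff_neg_of_mul_neg hu).1 (inv_pos.2 (norm_pos_iff.2 hne))
  have hev : ∀ᶠ t in 𝓝[>] (0 : ℝ), ρ (x + t • u) < 0 := by
    have h3 := (hasDerivAt_iff_tendsto_slope.1 hg).eventually (gt_mem_nhds hneg)
    have h4 : ∀ᶠ t in 𝓝[>] (0 : ℝ), slope (fun t : ℝ => ρ (x + t • u)) 0 t < 0 :=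
      h3.filter_mono (nhdsWithin_mono _ (fun t ht => ne_of_gt ht))
    filter_upwards [h4, self_mem_nhdsWithin] with t ht ht0
    simp only [slope, sub_zero, vsub_eq_sub, zero_smul, add_zero, hρx, smul_eq_mul] at ht
    exact (pos_iff_neg_of_mul_neg ht).1 (inv_pos.2 ht0)
  have hU' : ∀ᶠ t in 𝓝[>] (0 : ℝ), x + t • u ∈ U := by
    have : Tendsto (fun t : ℝ => x + t • u) (𝓝[>] 0) (𝓝 x) := by
      have := hline.continuousAt.tendsto
      simp only [zero_smul, add_zero] at this
      exact this.mono_left nhdsWithin_le_nhds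
    exact this.eventually (hU.mem_nhds hxU)
  filter_upwards [hev, hU'] with t h1 h2 using (hX _ h2).2 h1

theorem IsOutwardUnitNormal.notMem {x w : Space n} (h : IsOutwardUnitNormal X x w) : x ∉ X := by
  obtain ⟨U, ρ, hU, hxU, hρ, hX, hρx, hne, rfl⟩ := h
  rw [hX x hxU, hρx]
  exact lt_irrefl 0

/-- If some z ∈ X had ⟪w, z - x⟫ > 0, moving from x away from z would enter X, and x would lie
between two points of X. This gives the weak inequality; openness, through a small push of y along
w, makes it strict. -/
theorem IsOutwardUnitNormal.inner_sub_neg (hXo : IsOpen X) (hXc : Convex ℝ X) {x w : Space n}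
    (h : IsOutwardUnitNormal X x w) {y : Space n} (hy : y ∈ X) : ⟪w, y - x⟫ < 0 := by
  have hle : ∀ z ∈ X, ⟪w, z - x⟫ ≤ 0 := by
    intro z hz
    by_contra! hpos
    have hu : ⟪w, x - z⟫ < 0 := by
      rw [← neg_sub, inner_neg_right]; linarith
    obtain ⟨t, ht, ht0⟩ := ((h.eventually_mem hu).and self_mem_nhdsWithin).exists
    have ht0 : 0 < t := ht0
    refine h.notMem ?_
    have := hXc ht hz (a := 1 / (1 + t)) (b := t / (1 + t)) (by positivity) (by positivity)
      (by field_simp)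
    convert this using 1
    have h1 : (1 + t) ≠ 0 := by positivity
    match_scalars <;> field_simp
    ring
  have hw := h.norm_eq_one
  have hev : ∀ᶠ t in 𝓝[>] (0 : ℝ), y + t • w ∈ X := by
    have : Tendsto (fun t : ℝ => y + t • w) (𝓝[>] 0) (𝓝 y) := by
      have : Continuous (fun t : ℝ => y + t • w) := by fun_prop
      have := this.tendsto 0
      simp only [zero_smul, add_zero] at this
      exact this.mono_left nhdsWithin_le_nhds
    exact this.eventually (hXo.mem_nhds hy)
  obtain ⟨t, ht, ht0⟩ := (hev.and self_mem_nhdsWithin).exists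
  have ht0 : 0 < t := ht0
  have := hle _ ht
  rw [add_sub_right_comm, inner_add_right, real_inner_smul_right, real_inner_self_eq_norm_sq,
    hw] at this
  linarith

/-- A unit vector w' ≠ w yields the direction w' - w, which enters X at x but has positive inner
product with w'. So the supporting half-space at a C¹ point is unique. -/
theorem IsOutwardUnitNormal.eq_of_inner_nonpos {x w w' : Space n}
    (h : IsOutwardUnitNormal X x w) (hw' : ‖w'‖ = 1) (hle : ∀ y ∈ X, ⟪w', y - x⟫ ≤ 0) :
    w' = w := by
  by_contra hne
  have hw := h.norm_eq_one
  have hlt : ⟪w, w'⟫ < 1 := by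
    refine lt_of_le_of_ne ((real_inner_le_norm w w').trans (by rw [hw, hw']; norm_num)) ?_
    intro heq
    exact hne ((inner_eq_one_iff_of_norm_eq_one (𝕜 := ℝ) hw hw').1 heq).symm
  have hu : ⟪w, w' - w⟫ < 0 := by
    rw [inner_sub_right, real_inner_self_eq_norm_sq, hw]; linarith
  obtain ⟨t, ht, ht0⟩ := ((h.eventually_mem hu).and self_mem_nhdsWithin).exists
  have ht0 : 0 < t := ht0
  have := hle _ ht
  rw [add_sub_cancel_left, real_inner_smul_right, inner_sub_right, real_inner_self_eq_norm_sq,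
    hw', real_inner_comm] at this
  nlinarith

theorem IsOutwardUnitNormal.unique (hXo : IsOpen X) (hXc : Convex ℝ X) {x w w' : Space n}
    (h : IsOutwardUnitNormal X x w) (h' : IsOutwardUnitNormal X x w') : w' = w :=
  h.eq_of_inner_nonpos h'.norm_eq_one fun _ hy => (h'.inner_sub_neg hXo hXc hy).le

theorem isOutwardUnitNormal_outwardNormal (hX : HasC1Boundary X) {x : Space n}
    (hx : x ∈ frontier X) : IsOutwardUnitNormal X x (outwardNormal X x) := by
  have h := hX x hx
  rw [outwardNormal, dif_pos h]
  exact h.choose_spec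

/-- A defining function vanishes on the boundary near its base point. -/
theorem defining_eq_zero {U : Set (Space n)} {ρ : Space n → ℝ} (hXo : IsOpen X) (hU : IsOpen U)
    (hρ : ContDiffOn ℝ 1 ρ U) (hX : ∀ y ∈ U, y ∈ X ↔ ρ y < 0) {y : Space n} (hyU : y ∈ U)
    (hy : y ∈ frontier X) : ρ y = 0 := by
  refine le_antisymm ?_ ?_
  · by_contra! hpos
    have hc : ContinuousAt ρ y := hρ.continuousOn.continuousAt (hU.mem_nhds hyU)
    have hev : ∀ᶠ z in 𝓝 y, 0 < ρ z ∧ z ∈ U :=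
      (hc.eventually (lt_mem_nhds hpos)).and (hU.mem_nhds hyU)
    obtain ⟨z, ⟨h1, h2⟩, hz⟩ := mem_closure_iff_nhds.1 (frontier_subset_closure hy) _ hev
    exact absurd ((hX z h2).1 hz) (not_lt.2 h1.le)
  · rw [hXo.frontier_eq] at hy
    by_contra! hneg
    exact hy.2 ((hX y hyU).2 hneg)

/-- By uniqueness, the defining function chosen at x also computes the normal at every nearby
boundary point, where it is a normalised continuous gradient. -/
theorem continuousOn_outwardNormal (hXo : IsOpen X) (hXc : Convex ℝ X) (hX : HasC1Boundary X) :
    ContinuousOn (outwardNormal X) (frontier X) := by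
  intro x hx
  obtain ⟨U, ρ, hU, hxU, hρ, hUX, hρx, hne, hw⟩ := isOutwardUnitNormal_outwardNormal hX hx
  have hg : ContinuousAt (gradient ρ) x := by
    have h1 : ContinuousAt (fderiv ℝ ρ) x :=
      (hρ.continuousOn_fderiv_of_isOpen hU le_rfl).continuousAt (hU.mem_nhds hxU)
    exact (InnerProductSpace.toDual ℝ (Space n)).symm.continuous.continuousAt.comp h1
  have hev : ∀ᶠ y in 𝓝[frontier X] x,
      outwardNormal X y = ‖gradient ρ y‖⁻¹ • gradient ρ y := by
    filter_upwards [mem_nhdsWithin_of_mem_nhds (hU.mem_nhds hxU),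
      mem_nhdsWithin_of_mem_nhds (hg.eventually_ne hne), self_mem_nhdsWithin] with y hyU hy hyf
    exact ((isOutwardUnitNormal_outwardNormal hX hyf).unique hXo hXc
      ⟨U, ρ, hU, hyU, hρ, hUX, defining_eq_zero hXo hU hρ hUX hyU hyf, hy, rfl⟩).symm
  refine ContinuousWithinAt.congr_of_eventuallyEq ?_ hev hw
  exact ((hg.norm.inv₀ (norm_ne_zero_iff.2 hne)).smul hg).continuousWithinAt

/-- The boundary is flat to first order near each of its points. -/
theorem eventually_abs_inner_sub_le (hXo : IsOpen X) (hX : HasC1Boundary X) {x : Space n}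
    (hx : x ∈ frontier X) {δ : ℝ} (hδ : 0 < δ) :
    ∃ V ∈ 𝓝 x, ∀ y ∈ frontier X ∩ V, ∀ z ∈ frontier X ∩ V,
      |⟪outwardNormal X x, y - z⟫| ≤ δ * ‖y - z‖ := by
  obtain ⟨U, ρ, hU, hxU, hρ, hUX, hρx, hne, hw⟩ := isOutwardUnitNormal_outwardNormal hX hx
  -- Both y and z vary near x, so strict differentiability is what is required.
  have hs : HasStrictFDerivAt ρ (fderiv ℝ ρ x) x :=
    (hρ.contDiffAt (hU.mem_nhds hxU)).hasStrictFDerivAt (by norm_num)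
  have hg : 0 < ‖gradient ρ x‖ := norm_pos_iff.2 hne
  have hb := hs.isLittleO.bound (mul_pos hδ hg)
  rw [nhds_prod_eq] at hb
  obtain ⟨V, hV, hVb⟩ := eventually_prod_self_iff'.1 hb
  refine ⟨V ∩ U, inter_mem hV (hU.mem_nhds hxU), fun y hy z hz => ?_⟩
  have h1 := hVb y hy.2.1 z hz.2.1
  simp only [defining_eq_zero hXo hU hρ hUX hy.2.2 hy.1,
    defining_eq_zero hXo hU hρ hUX hz.2.2 hz.1, sub_zero, zero_sub, norm_neg] at h1
  have h2 : fderiv ℝ ρ x (y - z) = ⟪gradient ρ x, y - z⟫ := by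
    rw [gradient, InnerProductSpace.toDual_symm_apply]
  rw [h2, Real.norm_eq_abs] at h1
  rw [hw, real_inner_smul_left, abs_mul, abs_of_pos (inv_pos.2 hg), inv_mul_le_iff₀ hg]
  linarith

/-! ### Chords -/

/-- An open segment from a point of the closure to a point of the open convex set X stays in X.
Allowing p in the closure covers interior and boundary starting points at once. -/
theorem setOf_pos_mem_eq_Ioo (hXo : IsOpen X) (hXb : Bornology.IsBounded X) (hXc : Convex ℝ X)
    {p u : Space n} (hp : p ∈ closure X) (hu : ‖u‖ = 1) :
    {t : ℝ | 0 < t ∧ p + t • u ∈ X} = Ioo 0 (tauPlus X p u) := by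
  have hbdd : BddBelow {s : ℝ | 0 < s ∧ p + s • u ∉ X} := ⟨0, fun s hs => hs.1.le⟩
  have hne : {s : ℝ | 0 < s ∧ p + s • u ∉ X}.Nonempty := by
    obtain ⟨R, hR⟩ := hXb.subset_closedBall p
    refine ⟨|R| + 1, by positivity, fun hmem => ?_⟩
    have := hR hmem
    rw [mem_closedBall, dist_eq_norm, add_sub_cancel_left, norm_smul, hu, mul_one,
      Real.norm_eq_abs, abs_of_pos (by positivity)] at this
    linarith [le_abs_self R]
  ext t
  constructor
  · rintro ⟨ht, hmem⟩
    refine ⟨ht, ?_⟩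
    have hev : ∀ᶠ s in 𝓝[>] t, p + s • u ∈ X := by
      have : Continuous (fun t : ℝ => p + t • u) := by fun_prop
      exact (this.tendsto t).mono_left nhdsWithin_le_nhds |>.eventually (hXo.mem_nhds hmem)
    obtain ⟨s, hs, hts⟩ := (hev.and self_mem_nhdsWithin).exists
    have hts : t < s := hts
    refine hts.trans_le (le_csInf hne ?_)
    rintro r ⟨hr, hrX⟩
    by_contra! hrs
    refine hrX ?_
    have hop : openSegment ℝ p (p + s • u) ⊆ interior X :=
      hXc.openSegment_closure_interior_subset_interior hp (by rwa [hXo.interior_eq])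
    rw [hXo.interior_eq] at hop
    refine hop ⟨1 - r / s, r / s, ?_, div_pos hr (hr.trans hrs), by ring, ?_⟩
    · rw [sub_pos, div_lt_one (by linarith)]; exact hrs
    · have : s ≠ 0 := by linarith
      match_scalars <;> field_simp
      ring
  · rintro ⟨ht, htτ⟩
    refine ⟨ht, ?_⟩
    by_contra hmem
    exact absurd (csInf_le hbdd ⟨ht, hmem⟩) (not_le.2 htτ)

theorem tauMinus_eq_tauPlus_neg (p u : Space n) : tauMinus X p u = tauPlus X p (-u) := by
  simp only [tauMinus, tauPlus, smul_neg, sub_eq_add_neg]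

theorem add_smul_mem_iff (hXo : IsOpen X) (hXb : Bornology.IsBounded X) (hXc : Convex ℝ X)
    {p u : Space n} (hp : p ∈ closure X) (hu : ‖u‖ = 1) {t : ℝ} (ht : 0 < t) :
    p + t • u ∈ X ↔ t < tauPlus X p u := by
  have := Set.ext_iff.1 (setOf_pos_mem_eq_Ioo hXo hXb hXc hp hu) t
  simpa [ht] using this

theorem sub_smul_mem_iff (hXo : IsOpen X) (hXb : Bornology.IsBounded X) (hXc : Convex ℝ X)
    {p u : Space n} (hp : p ∈ closure X) (hu : ‖u‖ = 1) {t : ℝ} (ht : 0 < t) :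
    p - t • u ∈ X ↔ t < tauMinus X p u := by
  rw [tauMinus_eq_tauPlus_neg, ← add_smul_mem_iff hXo hXb hXc hp (by rwa [norm_neg]) ht,
    smul_neg, sub_eq_add_neg]

theorem tauPlus_nonneg (p u : Space n) : 0 ≤ tauPlus X p u :=
  Real.sInf_nonneg fun _ hs => hs.1.le

theorem tauMinus_nonneg (p u : Space n) : 0 ≤ tauMinus X p u :=
  Real.sInf_nonneg fun _ hs => hs.1.le

theorem tauMinus_pos (hXo : IsOpen X) (hXb : Bornology.IsBounded X) (hXc : Convex ℝ X)
    {p u : Space n} (hp : p ∈ X) (hu : ‖u‖ = 1) : 0 < tauMinus X p u := by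
  have hev : ∀ᶠ s in 𝓝[>] (0 : ℝ), p - s • u ∈ X := by
    have : Continuous (fun t : ℝ => p - t • u) := by fun_prop
    have h := (this.tendsto 0).mono_left (nhdsWithin_le_nhds (s := Ioi 0))
    simp only [zero_smul, sub_zero] at h
    exact h.eventually (hXo.mem_nhds hp)
  obtain ⟨s, hs, hs0⟩ := (hev.and self_mem_nhdsWithin).exists
  have hs0 : 0 < s := hs0
  exact hs0.trans ((sub_smul_mem_iff hXo hXb hXc (subset_closure hp) hu hs0).1 hs)

/-- The sign condition at the exit point is the strict supporting inequality there, tested on p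
itself. -/
theorem exit_mem_incoming (hXo : IsOpen X) (hXb : Bornology.IsBounded X) (hXc : Convex ℝ X)
    (hX : HasC1Boundary X) {p u : Space n} (hp : p ∈ X) (hu : ‖u‖ = 1) :
    (p - tauMinus X p u • u, u) ∈ incoming X := by
  have hpos := tauMinus_pos hXo hXb hXc hp hu
  have hfr : p - tauMinus X p u • u ∈ frontier X := by
    rw [hXo.frontier_eq]
    refine ⟨?_, fun hmem => ?_⟩
    · have hc : Continuous (fun t : ℝ => p - t • u) := by fun_prop
      have h := (hc.tendsto (tauMinus X p u)).mono_left
        (nhdsWithin_le_nhds (s := Iio (tauMinus X p u)))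
      refine mem_closure_of_tendsto h ?_
      filter_upwards [Ioo_mem_nhdsLT hpos] with t ht
      exact (sub_smul_mem_iff hXo hXb hXc (subset_closure hp) hu ht.1).2 ht.2
    · exact lt_irrefl _ ((sub_smul_mem_iff hXo hXb hXc (subset_closure hp) hu hpos).1 hmem)
  refine ⟨hfr, by simpa using hu, ?_⟩
  have := (isOutwardUnitNormal_outwardNormal hX hfr).inner_sub_neg hXo hXc hp
  rw [sub_sub_cancel, real_inner_smul_right] at this
  exact (pos_iff_neg_of_mul_neg this).1 hpos

/-- Tracing a ray backwards stops exactly at its boundary origin; this makes `entry` a left inverse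
of `rayPoint` on rays from Γ₋. -/
theorem tauMinus_add_smul (hXo : IsOpen X) (hXb : Bornology.IsBounded X) (hXc : Convex ℝ X)
    {p u : Space n} (hp : p ∈ frontier X) (hu : ‖u‖ = 1) {t : ℝ} (ht : 0 < t)
    (hmem : p + t • u ∈ X) : tauMinus X (p + t • u) u = t := by
  have hpX : p ∉ X := by rw [hXo.frontier_eq] at hp; exact hp.2
  have hτ := (add_smul_mem_iff hXo hXb hXc (frontier_subset_closure hp) hu ht).1 hmem
  refine le_antisymm ?_ (le_of_forall_lt fun s hs => ?_)
  · by_contra! hlt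
    refine hpX ?_
    have := (sub_smul_mem_iff hXo hXb hXc (subset_closure hmem) hu ht).2 hlt
    rwa [add_sub_cancel_right] at this
  · rcases le_or_gt s 0 with h0 | h0
    · exact h0.trans_lt (tauMinus_pos hXo hXb hXc hmem hu)
    · rw [← sub_smul_mem_iff hXo hXb hXc (subset_closure hmem) hu h0, add_sub_assoc, ← sub_smul,
        add_smul_mem_iff hXo hXb hXc (frontier_subset_closure hp) hu (by linarith)]
      linarith

theorem tauPlus_le_diam (hXo : IsOpen X) (hXb : Bornology.IsBounded X) (hXc : Convex ℝ X)
    {p u : Space n} (hp : p ∈ closure X) (hu : ‖u‖ = 1) : tauPlus X p u ≤ diam (closure X) := by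
  by_contra! hlt
  have hd : 0 ≤ diam (closure X) := diam_nonneg
  obtain ⟨s, hs1, hs2⟩ := exists_between hlt
  have hs0 : 0 < s := hd.trans_lt hs1
  have hmem := (add_smul_mem_iff hXo hXb hXc hp hu hs0).2 hs2
  have := dist_le_diam_of_mem hXb.closure (subset_closure hmem) hp
  rw [dist_eq_norm, add_sub_cancel_left, norm_smul, hu, mul_one, Real.norm_eq_abs,
    abs_of_pos hs0] at this
  linarith

end ConvexGeometry

end Photoacoustic

namespace Photoacoustic

/-! ### The area formula for projections of the boundary -/

section Area

variable {n : ℕ}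

/-- The projection onto the hyperplane `wᗮ` along the direction `v`. -/
noncomputable def slide (w v : Space n) : Space n →ₗ[ℝ] Space n where
  toFun x := x - (⟪w, x⟫ / ⟪w, v⟫) • v
  map_add' x y := by rw [inner_add_right, add_div, add_smul]; abel
  map_smul' r x := by
    simp only [inner_smul_right, RingHom.id_apply, smul_sub, smul_smul, mul_div_assoc]

theorem slide_apply (w v x : Space n) : slide w v x = x - (⟪w, x⟫ / ⟪w, v⟫) • v := rfl

theorem slide_self_apply {v : Space n} (hv : ‖v‖ = 1) (x : Space n) :
    slide v v x = x - ⟪v, x⟫ • v := by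
  rw [slide_apply, real_inner_self_eq_norm_sq, hv, one_pow, div_one]

theorem continuous_slide (w v : Space n) : Continuous (slide w v) :=
  (slide w v).continuous_of_finiteDimensional

theorem inner_slide {w v : Space n} (h : ⟪w, v⟫ ≠ 0) (x : Space n) : ⟪w, slide w v x⟫ = 0 := by
  rw [slide_apply, inner_sub_right, real_inner_smul_right, div_mul_cancel₀ _ h, sub_self]

theorem slide_add_smul {w v : Space n} (h : ⟪w, v⟫ ≠ 0) (x : Space n) (t : ℝ) :
    slide w v (x + t • v) = slide w v x := by
  simp only [slide_apply, inner_add_right, real_inner_smul_right, add_div, mul_div_cancel_right₀ _ h,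
    add_smul]
  abel

theorem slide_self_slide {w v : Space n} (hv : ‖v‖ = 1) (x : Space n) :
    slide v v (slide w v x) = slide v v x := by
  have hvv : ⟪v, v⟫ ≠ 0 := by rw [real_inner_self_eq_norm_sq, hv]; norm_num
  rw [slide_apply w v, sub_eq_add_neg, ← neg_smul, slide_add_smul hvv]

/-- With u the component of v in wᗮ, the restricted projection L satisfies L*L = id - u ⊗ u, whose
determinant is 1 - |u|² = ⟪w, v⟫². -/
theorem normDet_slide_orthogonal {v w : Space n} (hv : ‖v‖ = 1) (hw : ‖w‖ = 1) :
    ((slide v v) ∘ₗ (ℝ ∙ w)ᗮ.subtype).normDet = |⟪w, v⟫| := by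
  set L := (slide v v) ∘ₗ (ℝ ∙ w)ᗮ.subtype with hL
  have hu : v - ⟪w, v⟫ • w ∈ (ℝ ∙ w)ᗮ := by
    rw [Submodule.mem_orthogonal_singleton_iff_inner_right, inner_sub_right,
      real_inner_smul_right, real_inner_self_eq_norm_sq, hw]
    ring
  set u : (ℝ ∙ w)ᗮ := ⟨v - ⟪w, v⟫ • w, hu⟩ with hudef
  have hinner : ∀ y : (ℝ ∙ w)ᗮ, ⟪u, y⟫ = ⟪v, (y : Space n)⟫ := by
    intro y
    have hy := Submodule.mem_orthogonal_singleton_iff_inner_right.1 y.2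
    rw [Submodule.coe_inner, hudef, inner_sub_left, real_inner_smul_left, hy]
    ring
  -- A rank-one perturbation of the identity is written as a transvection because its determinant is
  -- then immediate.
  have hcomp : L.adjoint ∘ₗ L =
      LinearMap.transvection (-(innerₛₗ ℝ u)) u := by
    refine LinearMap.ext fun y => ext_inner_left ℝ fun z => ?_
    rw [LinearMap.comp_apply, LinearMap.adjoint_inner_right]
    have hLz : ∀ z : (ℝ ∙ w)ᗮ, L z = (z : Space n) - ⟪v, (z : Space n)⟫ • v := fun z => by
      rw [hL, LinearMap.comp_apply, slide_self_apply hv]; rfl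
    rw [hLz, hLz, LinearMap.transvection.apply, LinearMap.neg_apply, innerₛₗ_apply_apply,
      inner_add_right, real_inner_smul_right, hinner, real_inner_comm u z, hinner,
      inner_sub_left, inner_sub_right, inner_sub_right, real_inner_smul_left,
      real_inner_smul_left, real_inner_smul_right, real_inner_smul_right,
      real_inner_self_eq_norm_sq, hv, Submodule.coe_inner, real_inner_comm v (z : Space n)]
    ring
  have hsq : L.normDet ^ 2 = ⟪w, v⟫ ^ 2 := by
    have h1 := L.normDet_sq
    rw [hcomp, LinearMap.transvection.det, LinearMap.neg_apply, innerₛₗ_apply_apply, hinner,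
      hudef] at h1
    simp only [inner_sub_right, real_inner_smul_right, real_inner_self_eq_norm_sq, hv,
      real_inner_comm w v] at h1
    simp only [RCLike.ofReal_real_eq_id, id] at h1
    rw [h1]; ring
  rw [← abs_of_nonneg L.normDet_nonneg, ← sq_eq_sq_iff_abs_eq_abs, hsq]

theorem finrank_orthogonal_singleton {w : Space n} (hw : ‖w‖ = 1) :
    Module.finrank ℝ (ℝ ∙ w)ᗮ = n - 1 := by
  have hne : w ≠ 0 := by rintro rfl; simp at hw
  have h := (ℝ ∙ w).finrank_add_finrank_orthogonal
  rw [finrank_span_singleton hne, finrank_euclideanSpace_fin] at h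
  omega

theorem coe_image_preimage_orthogonal {w : Space n} {B : Set (Space n)}
    (hB : ∀ x ∈ B, ⟪w, x⟫ = 0) :
    (ℝ ∙ w)ᗮ.subtypeₗᵢ '' ((ℝ ∙ w)ᗮ.subtypeₗᵢ ⁻¹' B) = B := by
  refine image_preimage_eq_of_subset fun x hx => ⟨⟨x, ?_⟩, rfl⟩
  exact Submodule.mem_orthogonal_singleton_iff_inner_right.2 (hB x hx)

/-- This is the area formula for a flat boundary piece, to which the curved case is reduced. -/
theorem euclideanHausdorffMeasure_slide_image {v w : Space n} (hv : ‖v‖ = 1) (hw : ‖w‖ = 1)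
    {B : Set (Space n)} (hB : ∀ x ∈ B, ⟪w, x⟫ = 0) :
    μHE[n - 1] (slide v v '' B) = ENNReal.ofReal |⟪w, v⟫| * μHE[n - 1] B := by
  have h := ((slide v v) ∘ₗ (ℝ ∙ w)ᗮ.subtype).euclideanHausdorffMeasure_image
    ((ℝ ∙ w)ᗮ.subtypeₗᵢ ⁻¹' B)
  rw [normDet_slide_orthogonal hv hw, finrank_orthogonal_singleton hw,
    ← (ℝ ∙ w)ᗮ.subtypeₗᵢ.isometry.euclideanHausdorffMeasure_image,
    coe_image_preimage_orthogonal hB] at h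
  rw [← h, LinearMap.coe_comp, image_comp]
  congr 2
  exact (coe_image_preimage_orthogonal hB).symm

theorem euclideanHausdorffMeasure_lt_top_of_subset_hyperplane {w : Space n} (hw : ‖w‖ = 1)
    {B : Set (Space n)} (hB : ∀ x ∈ B, ⟪w, x⟫ = 0) (hb : Bornology.IsBounded B) :
    μHE[n - 1] B < ⊤ := by
  rw [← coe_image_preimage_orthogonal hB, (ℝ ∙ w)ᗮ.subtypeₗᵢ.isometry.euclideanHausdorffMeasure_image,
    ← finrank_orthogonal_singleton hw, InnerProductSpace.euclideanHausdorffMeasure_eq_volume]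
  exact ((ℝ ∙ w)ᗮ.subtypeₗᵢ.isometry.antilipschitz.isBounded_preimage hb).measure_lt_top

theorem euclideanHausdorffMeasure_image_le {Y Z : Type*} [MetricSpace Y] [MeasurableSpace Y]
    [BorelSpace Y] [MetricSpace Z] [MeasurableSpace Z] [BorelSpace Z] {f : Y → Z} {s : Set Y}
    {K : NNReal} (hf : LipschitzOnWith K f s) (d : ℕ) :
    μHE[d] (f '' s) ≤ (K : ENNReal) ^ d * μHE[d] s := by
  have h := hf.hausdorffMeasure_image_le (d := d) (by positivity)
  rw [ENNReal.rpow_natCast] at h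
  simp only [Measure.euclideanHausdorffMeasure_def, Measure.smul_apply, ENNReal.smul_def,
    smul_eq_mul]
  rw [mul_left_comm]
  gcongr

/-- A set which is nearly flat with normal `w` is distorted little by the projection onto `wᗮ`
along `v`. -/
theorem slide_bilipschitz {v w : Space n} (hv : ‖v‖ = 1) (hwv : ⟪w, v⟫ ≠ 0) {K : NNReal}
    (hK : 1 < K) {A : Set (Space n)}
    (hA : ∀ y ∈ A, ∀ z ∈ A, |⟪w, y - z⟫| ≤ |⟪w, v⟫| * (1 - 1 / K) * ‖y - z‖) (d : ℕ) :
    μHE[d] (slide w v '' A) ≤ (K : ENNReal) ^ d * μHE[d] A ∧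
      μHE[d] A ≤ (K : ENNReal) ^ d * μHE[d] (slide w v '' A) := by
  have hK' : (1 : ℝ) < K := by exact_mod_cast hK
  have hc : 0 < |⟪w, v⟫| := abs_pos.2 hwv
  have hdist : ∀ y ∈ A, ∀ z ∈ A,
      ‖(slide w v y - slide w v z) - (y - z)‖ ≤ (1 - 1 / K) * ‖y - z‖ := by
    intro y hy z hz
    rw [← map_sub, slide_apply, sub_sub_cancel_left, norm_neg, norm_smul, hv, mul_one,
      Real.norm_eq_abs, abs_div, div_le_iff₀ hc]
    linarith [hA y hy z hz]
  -- The flatness constant 1 - 1/K is chosen so that the lower bound is exactly 1/K; the upper bound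
  -- 2 - 1/K is at most K since (K - 1)² ≥ 0.
  have hKK : (1 : ℝ) + (1 - 1 / K) ≤ K := by
    have h0 : (0 : ℝ) < K := by linarith
    have : (0 : ℝ) ≤ (K - 1) ^ 2 / K := by positivity
    have h2 : (K - 1 : ℝ) ^ 2 / K = K - 2 + 1 / K := by field_simp; ring
    linarith
  have hup : ∀ y ∈ A, ∀ z ∈ A, ‖slide w v y - slide w v z‖ ≤ K * ‖y - z‖ := by
    intro y hy z hz
    have h1 := hdist y hy z hz
    have h2 := norm_le_norm_add_norm_sub' (slide w v y - slide w v z) (y - z)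
    nlinarith [norm_nonneg (y - z)]
  have hlow : ∀ y ∈ A, ∀ z ∈ A, ‖y - z‖ ≤ K * ‖slide w v y - slide w v z‖ := by
    intro y hy z hz
    have h1 := hdist y hy z hz
    have h2 := norm_le_norm_add_norm_sub (slide w v y - slide w v z) (y - z)
    have h3 : (1 / K : ℝ) * ‖y - z‖ ≤ ‖slide w v y - slide w v z‖ := by linarith
    rwa [one_div, inv_mul_le_iff₀ (by linarith)] at h3
  constructor
  · refine euclideanHausdorffMeasure_image_le (LipschitzOnWith.of_dist_le_mul fun y hy z hz => ?_) d
    simpa only [dist_eq_norm] using hup y hy z hz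
  · have hinj : InjOn (slide w v) A := by
      intro y hy z hz hyz
      have := hlow y hy z hz
      rw [hyz, sub_self, norm_zero, mul_zero] at this
      exact sub_eq_zero.1 (norm_le_zero_iff.1 this)
    have hlip : LipschitzOnWith K (Function.invFunOn (slide w v) A) (slide w v '' A) := by
      refine LipschitzOnWith.of_dist_le_mul ?_
      rintro _ ⟨y, hy, rfl⟩ _ ⟨z, hz, rfl⟩
      rw [hinj.leftInvOn_invFunOn hy, hinj.leftInvOn_invFunOn hz, dist_eq_norm, dist_eq_norm]
      exact hlow y hy z hz
    have := euclideanHausdorffMeasure_image_le hlip d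
    rwa [hinj.invFunOn_image Subset.rfl] at this

/-- Two countably additive set functions that compare locally up to factors close to one
compare globally. -/
theorem le_of_locally_le_mul {Y : Type*} [TopologicalSpace Y] [SecondCountableTopology Y]
    [MeasurableSpace Y] [BorelSpace Y] {S : Set Y} {F G : Set Y → ENNReal}
    (hF0 : F ∅ = 0)
    (hF : ∀ f : ℕ → Set Y, (∀ i, MeasurableSet (f i)) → (∀ i, f i ⊆ S) →
      Pairwise (Function.onFun Disjoint f) → F (⋃ i, f i) = ∑' i, F (f i))
    (hG : ∀ f : ℕ → Set Y, (∀ i, MeasurableSet (f i)) → (∀ i, f i ⊆ S) →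
      Pairwise (Function.onFun Disjoint f) → G (⋃ i, f i) = ∑' i, G (f i)) (d : ℕ)
    (hloc : ∀ x ∈ S, ∀ K : NNReal, 1 < K → ∃ V ∈ 𝓝 x, ∀ A ⊆ S ∩ V, MeasurableSet A →
      F A ≤ (K : ENNReal) ^ d * G A)
    {A : Set Y} (hA : MeasurableSet A) (hAS : A ⊆ S) : F A ≤ G A := by
  have key : ∀ K : NNReal, 1 < K → F A ≤ (K : ENNReal) ^ d * G A := by
    intro K hK
    choose! V hV hVA using fun x hx => hloc x hx K hK
    obtain ⟨t, htS, htc, htV⟩ := TopologicalSpace.countable_cover_nhdsWithin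
      (s := S) (f := fun x => interior (V x))
      fun x hx => mem_nhdsWithin_of_mem_nhds (interior_mem_nhds.2 (hV x hx))
    rcases t.eq_empty_or_nonempty with rfl | hne
    · have hSe : S = ∅ := by simpa using htV
      obtain rfl : A = ∅ := by simpa [hSe] using hAS
      simp [hF0]
    · obtain ⟨e, rfl⟩ := htc.exists_eq_range hne
      -- A countable cover by good neighbourhoods is made disjoint, so the local comparison can be
      -- summed.
      set f : ℕ → Set Y := fun i => A ∩ disjointed (fun i => interior (V (e i))) i with hf
      have hfm : ∀ i, MeasurableSet (f i) := fun i =>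
        hA.inter (MeasurableSet.disjointed (fun i => isOpen_interior.measurableSet) i)
      have hfS : ∀ i, f i ⊆ S := fun i => inter_subset_left.trans hAS
      have hfd : Pairwise (Function.onFun Disjoint f) := fun i j hij =>
        (disjoint_disjointed _ hij).mono inter_subset_right inter_subset_right
      have hfU : ⋃ i, f i = A := by
        rw [hf, ← inter_iUnion, iUnion_disjointed, inter_eq_left]
        refine hAS.trans (htV.trans ?_)
        rw [biUnion_range]
      rw [← hfU, hF f hfm hfS hfd, hG f hfm hfS hfd, ← ENNReal.tsum_mul_left]
      refine ENNReal.tsum_le_tsum fun i => ?_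
      refine hVA (e i) (htS (mem_range_self i)) _ (subset_inter (hfS i) ?_) (hfm i)
      exact inter_subset_right.trans ((disjointed_subset _ _).trans interior_subset)
  have hlim : Tendsto (fun K : NNReal => (K : ENNReal) ^ d * G A) (𝓝[>] 1) (𝓝 (1 * G A)) := by
    refine ENNReal.Tendsto.mul_const ?_ (Or.inl one_ne_zero)
    have : Continuous fun K : NNReal => ((K ^ d : NNReal) : ENNReal) := by fun_prop
    have h := (this.tendsto 1).mono_left (nhdsWithin_le_nhds (s := Ioi 1))
    simpa using h
  rw [one_mul] at hlim
  exact ge_of_tendsto hlim (by filter_upwards [self_mem_nhdsWithin] with K hK using key K hK)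

variable {X : Set (Space n)}

theorem outwardNormal_norm (hX : HasC1Boundary X) {x : Space n} (hx : x ∈ frontier X) :
    ‖outwardNormal X x‖ = 1 :=
  (isOutwardUnitNormal_outwardNormal hX hx).norm_eq_one

/-- The boundary points at which the direction `v` points into `X`. -/
def incomingAt (X : Set (Space n)) (v : Space n) : Set (Space n) :=
  {x | x ∈ frontier X ∧ ⟪outwardNormal X x, v⟫ < 0}

/-- If two incoming points lie on one line parallel to v, the supporting half-space at each puts the
other ahead of it along v, so they coincide. -/
theorem injOn_slide_incomingAt (hXo : IsOpen X) (hXc : Convex ℝ X) (hX : HasC1Boundary X)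
    {v : Space n} (hv : ‖v‖ = 1) : InjOn (slide v v) (incomingAt X v) := by
  have hle : ∀ y ∈ incomingAt X v, ∀ z ∈ incomingAt X v, slide v v y = slide v v z →
      0 ≤ ⟪v, z - y⟫ := by
    intro y hy z hz hyz
    have hcl : ∀ p ∈ closure X, ⟪outwardNormal X y, p - y⟫ ≤ 0 := by
      have hclosed : IsClosed {p | ⟪outwardNormal X y, p - y⟫ ≤ 0} :=
        isClosed_le (by fun_prop) continuous_const
      exact closure_minimal (fun p hp => ((isOutwardUnitNormal_outwardNormal hX
        hy.1).inner_sub_neg hXo hXc hp).le) hclosed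
    have h1 := hcl z (frontier_subset_closure hz.1)
    rw [slide_self_apply hv, slide_self_apply hv] at hyz
    have h2 : z - y = ⟪v, z - y⟫ • v := by
      rw [inner_sub_right, sub_smul]
      linear_combination (norm := module) (-1 : ℝ) • hyz
    rw [h2, real_inner_smul_right] at h1
    by_contra! hneg
    exact absurd h1 (not_le.2 (mul_pos_of_neg_of_neg hneg hy.2))
  intro y hy z hz hyz
  have h1 := hle y hy z hz hyz
  have h2 := hle z hz y hy hyz.symm
  rw [slide_self_apply hv, slide_self_apply hv] at hyz
  rw [inner_sub_right] at h1 h2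
  have h3 : ⟪v, y⟫ = ⟪v, z⟫ := by linarith
  rw [h3] at hyz
  exact sub_left_injective hyz

theorem measurableSet_incomingAt (hXo : IsOpen X) (hXc : Convex ℝ X) (hX : HasC1Boundary X)
    (v : Space n) : MeasurableSet (incomingAt X v) := by
  have hc : ContinuousOn (fun x => ⟪outwardNormal X x, v⟫) (frontier X) :=
    (continuousOn_outwardNormal hXo hXc hX).inner continuousOn_const
  obtain ⟨U, hU, hUeq⟩ := (_root_.continuousOn_iff'.1 hc) (Iio 0) isOpen_Iio
  have : incomingAt X v = U ∩ frontier X := by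
    rw [← hUeq, inter_comm]; rfl
  rw [this]
  exact hU.measurableSet.inter isClosed_frontier.measurableSet

/-- Near each point the boundary is bi-Lipschitz to a bounded piece of a hyperplane, and the
boundary is compact. -/
theorem euclideanHausdorffMeasure_frontier_lt_top (hXo : IsOpen X) (hXb : Bornology.IsBounded X)
    (hX : HasC1Boundary X) : μHE[n - 1] (frontier X) < ⊤ := by
  have hcomp : IsCompact (frontier X) :=
    isCompact_of_isClosed_isBounded isClosed_frontier (hXb.closure.subset frontier_subset_closure)
  refine hcomp.measure_lt_top_of_nhdsWithin fun x hx => ?_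
  have hw := outwardNormal_norm hX hx
  have hww : ⟪outwardNormal X x, outwardNormal X x⟫ = 1 := by
    rw [real_inner_self_eq_norm_sq, hw, one_pow]
  -- The value 1/2 is 1 - 1/K for K = 2; here the direction of projection is the normal itself.
  obtain ⟨V, hV, hVb⟩ := eventually_abs_inner_sub_le hXo hX hx (δ := 1 / 2) (by norm_num)
  refine ⟨frontier X ∩ V, inter_mem_nhdsWithin _ hV, ?_⟩
  have hb : Bornology.IsBounded (frontier X ∩ V) := hcomp.isBounded.subset inter_subset_left
  refine ((slide_bilipschitz hw (by rw [hww]; norm_num) (K := 2) (by norm_num)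
    (fun y hy z hz => ?_) (n - 1)).2).trans_lt ?_
  · refine (hVb y hy z hz).trans_eq ?_
    rw [hww]; norm_num
  · refine ENNReal.mul_lt_top (by simp) ?_
    refine euclideanHausdorffMeasure_lt_top_of_subset_hyperplane hw
      (w := outwardNormal X x) ?_ ?_
    · rintro _ ⟨y, -, rfl⟩
      exact inner_slide (by rw [hww]; norm_num) y
    · exact (slide _ _).toContinuousLinearMap.lipschitz.isBounded_image hb

/-- The area formula for the projection of the incoming part of the boundary onto a hyperplane. -/
theorem setLIntegral_abs_inner_outwardNormal (hXo : IsOpen X) (hXc : Convex ℝ X)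
    (hX : HasC1Boundary X) {v : Space n} (hv : ‖v‖ = 1) {A : Set (Space n)}
    (hA : MeasurableSet A) (hAv : A ⊆ incomingAt X v) :
    ∫⁻ x in A, ENNReal.ofReal |⟪outwardNormal X x, v⟫| ∂μHE[n - 1] =
      μHE[n - 1] (slide v v '' A) := by
  -- Of the n factors K, n - 1 come from the bi-Lipschitz distortion of (n-1)-dimensional measure
  -- and one from the oscillation of |ν · v|.
  have hloc : ∀ x ∈ incomingAt X v, ∀ K : NNReal, 1 < K → ∃ V ∈ 𝓝 x,
      ∀ A ⊆ incomingAt X v ∩ V, MeasurableSet A →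
      ∫⁻ x in A, ENNReal.ofReal |⟪outwardNormal X x, v⟫| ∂μHE[n - 1] ≤
        (K : ENNReal) ^ (n - 1 + 1) * μHE[n - 1] (slide v v '' A) ∧
      μHE[n - 1] (slide v v '' A) ≤ (K : ENNReal) ^ (n - 1 + 1) *
        ∫⁻ x in A, ENNReal.ofReal |⟪outwardNormal X x, v⟫| ∂μHE[n - 1] := by
    intro x hx K hK
    have hK' : (1 : ℝ) < K := by exact_mod_cast hK
    have hK0 : (0 : ℝ) < K := by linarith
    set w := outwardNormal X x with hwdef
    have hw : ‖w‖ = 1 := outwardNormal_norm hX hx.1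
    have hwv : ⟪w, v⟫ ≠ 0 := hx.2.ne
    set c := |⟪w, v⟫| with hc
    have hc0 : 0 < c := abs_pos.2 hwv
    have hδ : 0 < c * (1 - 1 / K) := by
      have : 1 / (K : ℝ) < 1 := by rw [div_lt_one hK0]; exact hK'
      exact mul_pos hc0 (by linarith)
    obtain ⟨V, hV, hVb⟩ := eventually_abs_inner_sub_le hXo hX hx.1 hδ
    have hcont : ContinuousWithinAt (fun y => |⟪outwardNormal X y, v⟫|) (frontier X) x :=
      (((continuousOn_outwardNormal hXo hXc hX).inner continuousOn_const).abs) x hx.1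
    have hev : ∀ᶠ y in 𝓝[frontier X] x,
        |⟪outwardNormal X y, v⟫| ∈ Ioo (c / K) (c * K) :=
      hcont.eventually (Ioo_mem_nhds (div_lt_self hc0 hK') (lt_mul_of_one_lt_right hc0 hK'))
    obtain ⟨W, hW, hWb⟩ := mem_nhdsWithin_iff_exists_mem_nhds_inter.1 hev
    refine ⟨V ∩ W, inter_mem hV hW, fun A hAs hAm => ?_⟩
    have hAf : A ⊆ frontier X ∩ V := fun y hy => ⟨(hAs hy).1.1, (hAs hy).2.1⟩
    have hAn : ∀ y ∈ A, |⟪outwardNormal X y, v⟫| ∈ Ioo (c / K) (c * K) := fun y hy =>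
      hWb ⟨(hAs hy).2.2, (hAs hy).1.1⟩
    obtain ⟨hb1, hb2⟩ := slide_bilipschitz hv hwv hK
      (fun y hy z hz => hVb y (hAf hy) z (hAf hz)) (n - 1)
    -- Projecting along v first onto the tangent hyperplane does not change the image in vᗮ, so the
    -- exact factor for hyperplanes applies to the second projection.
    have hproj : μHE[n - 1] (slide v v '' A) =
        ENNReal.ofReal c * μHE[n - 1] (slide w v '' A) := by
      rw [← euclideanHausdorffMeasure_slide_image hv hw, image_image]
      · simp only [slide_self_slide hv]
      · rintro _ ⟨y, -, rfl⟩
        exact inner_slide hwv y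
    have hKc : ENNReal.ofReal (K : ℝ) = K := ENNReal.ofReal_coe_nnreal
    constructor
    · calc ∫⁻ x in A, ENNReal.ofReal |⟪outwardNormal X x, v⟫| ∂μHE[n - 1]
          ≤ ∫⁻ x in A, ENNReal.ofReal (c * K) ∂μHE[n - 1] :=
            setLIntegral_mono' hAm fun y hy => ENNReal.ofReal_le_ofReal (hAn y hy).2.le
        _ = ENNReal.ofReal c * K * μHE[n - 1] A := by
            rw [setLIntegral_const, ENNReal.ofReal_mul hc0.le, hKc]
        _ ≤ ENNReal.ofReal c * K * ((K : ENNReal) ^ (n - 1) * μHE[n - 1] (slide w v '' A)) := by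
            gcongr
        _ = _ := by rw [hproj]; ring
    · have hlow : ENNReal.ofReal c * μHE[n - 1] A ≤ K *
          ∫⁻ x in A, ENNReal.ofReal |⟪outwardNormal X x, v⟫| ∂μHE[n - 1] := by
        calc ENNReal.ofReal c * μHE[n - 1] A
            = K * ∫⁻ x in A, ENNReal.ofReal (c / K) ∂μHE[n - 1] := by
              rw [setLIntegral_const, ← mul_assoc, ← hKc, ← ENNReal.ofReal_mul hK0.le,
                mul_div_cancel₀ _ hK0.ne']
          _ ≤ _ := by
              refine mul_le_mul_right (setLIntegral_mono' hAm fun y hy => ?_) _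
              exact ENNReal.ofReal_le_ofReal (hAn y hy).1.le
      calc μHE[n - 1] (slide v v '' A)
          ≤ ENNReal.ofReal c * ((K : ENNReal) ^ (n - 1) * μHE[n - 1] A) := by
            rw [hproj]; gcongr
        _ = (K : ENNReal) ^ (n - 1) * (ENNReal.ofReal c * μHE[n - 1] A) := by ring
        _ ≤ (K : ENNReal) ^ (n - 1) * (K *
            ∫⁻ x in A, ENNReal.ofReal |⟪outwardNormal X x, v⟫| ∂μHE[n - 1]) := by gcongr
        _ = _ := by ring
  have hF : ∀ f : ℕ → Set (Space n), (∀ i, MeasurableSet (f i)) →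
      (∀ i, f i ⊆ incomingAt X v) → Pairwise (Function.onFun Disjoint f) →
      ∫⁻ x in ⋃ i, f i, ENNReal.ofReal |⟪outwardNormal X x, v⟫| ∂μHE[n - 1] =
        ∑' i, ∫⁻ x in f i, ENNReal.ofReal |⟪outwardNormal X x, v⟫| ∂μHE[n - 1] :=
    fun f hf _ hd => lintegral_iUnion hf hd _
  have hinj := injOn_slide_incomingAt hXo hXc hX hv
  have hG : ∀ f : ℕ → Set (Space n), (∀ i, MeasurableSet (f i)) →
      (∀ i, f i ⊆ incomingAt X v) → Pairwise (Function.onFun Disjoint f) →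
      μHE[n - 1] (slide v v '' ⋃ i, f i) = ∑' i, μHE[n - 1] (slide v v '' f i) := by
    intro f hf hS hd
    rw [image_iUnion, measure_iUnion]
    · intro i j hij
      exact disjoint_image_image fun x hx y hy hxy =>
        disjoint_left.1 (hd hij) hx (hinj (hS i hx) (hS j hy) hxy ▸ hy)
    · intro i
      exact (hf i).image_of_continuousOn_injOn (continuous_slide v v).continuousOn
        (hinj.mono (hS i))
  refine le_antisymm ?_ ?_
  · refine le_of_locally_le_mul (F := fun A => ∫⁻ x in A, ENNReal.ofReal
      |⟪outwardNormal X x, v⟫| ∂μHE[n - 1]) (G := fun A => μHE[n - 1] (slide v v '' A))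
      (by simp) hF hG (n - 1 + 1) (fun x hx K hK => ?_) hA hAv
    obtain ⟨V, hV, h⟩ := hloc x hx K hK
    exact ⟨V, hV, fun A hA hAm => (h A hA hAm).1⟩
  · refine le_of_locally_le_mul (G := fun A => ∫⁻ x in A, ENNReal.ofReal
      |⟪outwardNormal X x, v⟫| ∂μHE[n - 1]) (F := fun A => μHE[n - 1] (slide v v '' A))
      (by simp) hG hF (n - 1 + 1) (fun x hx K hK => ?_) hA hAv
    obtain ⟨V, hV, h⟩ := hloc x hx K hK
    exact ⟨V, hV, fun A hA hAm => (h A hA hAm).2⟩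

end Area

end Photoacoustic

namespace Photoacoustic

/-! ### Foliation of phase space by rays from the incoming boundary -/

section Disintegration

variable {n : ℕ} {X : Set (Space n)}

/-- Fubini for the orthogonal splitting into the line ℝv and vᗮ, with Lebesgue measure on vᗮ
expressed as a Hausdorff measure of the ambient space. -/
theorem lintegral_eq_lintegral_hyperplane {v : Space n} (hv : ‖v‖ = 1) {f : Space n → ENNReal}
    (hf : Measurable f) :
    ∫⁻ y, f y = ∫⁻ y in {y | ⟪v, y⟫ = 0}, (∫⁻ t : ℝ, f (y + t • v)) ∂μHE[n - 1] := by
  set s : Submodule ℝ (Space n) := ℝ ∙ v with hs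
  have h1 := (s.measurePreserving_measurableEquivProd (0 : Space n)).symm
  rw [InnerProductSpace.euclideanHausdorffMeasure_eq_volume] at h1
  have h2 := (LinearIsometryEquiv.toSpanUnitSingleton v hv (𝕜 := ℝ)).measurePreserving
  have hm : Measurable fun p : s × sᗮ => f ((p.1 : Space n) + p.2) := by fun_prop
  have hrange : range sᗮ.subtypeₗᵢ = {y | ⟪v, y⟫ = 0} := by
    ext y
    constructor
    · rintro ⟨z, rfl⟩
      exact Submodule.mem_orthogonal_singleton_iff_inner_right.1 z.2
    · intro hy
      exact ⟨⟨y, Submodule.mem_orthogonal_singleton_iff_inner_right.2 hy⟩, rfl⟩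
  have h3 := sᗮ.subtypeₗᵢ.isometry.map_euclideanHausdorffMeasure (d := n - 1)
  rw [hrange, ← finrank_orthogonal_singleton hv,
    InnerProductSpace.euclideanHausdorffMeasure_eq_volume, finrank_orthogonal_singleton hv] at h3
  have hm2 : Measurable fun y : Space n => ∫⁻ t : ℝ, f (y + t • v) := by
    refine Measurable.lintegral_prod_right' (f := fun p : Space n × ℝ => f (p.1 + p.2 • v)) ?_
    fun_prop
  rw [← h3, lintegral_map hm2 sᗮ.subtypeₗᵢ.continuous.measurable, ← h1.lintegral_comp hf]
  simp only [Submodule.measurableEquivProd_symm_apply, vadd_eq_add, add_zero]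
  rw [Measure.volume_eq_prod, lintegral_prod_symm _ hm.aemeasurable]
  refine lintegral_congr fun b => ?_
  have hm3 : Measurable fun a : s => f ((a : Space n) + b) := by fun_prop
  rw [← h2.lintegral_comp hm3]
  refine lintegral_congr fun t => ?_
  rw [add_comm]
  rfl

theorem pos_of_add_smul_mem (hXo : IsOpen X) (hXc : Convex ℝ X) (hX : HasC1Boundary X)
    {x v : Space n} (hx : x ∈ incomingAt X v) {t : ℝ} (ht : x + t • v ∈ X) : 0 < t := by
  have h := (isOutwardUnitNormal_outwardNormal hX hx.1).inner_sub_neg hXo hXc ht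
  rw [add_sub_cancel_left, real_inner_smul_right] at h
  by_contra! hle
  exact absurd h (not_lt.2 (mul_nonneg_of_nonpos_of_nonpos hle hx.2.le))

/-- The area formula read on preimages: the flux density at fixed v becomes plain surface measure on
the shadow in vᗮ. -/
theorem map_slide_withDensity (hXo : IsOpen X) (hXc : Convex ℝ X)
    (hX : HasC1Boundary X) {v : Space n} (hv : ‖v‖ = 1) :
    ((μHE[n - 1].restrict (incomingAt X v)).withDensity
      fun x => ENNReal.ofReal |⟪outwardNormal X x, v⟫|).map (slide v v) =
      μHE[n - 1].restrict (slide v v '' incomingAt X v) := by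
  have hΓ := measurableSet_incomingAt hXo hXc hX v
  ext B hB
  have hB' : MeasurableSet (slide v v ⁻¹' B) := (continuous_slide v v).measurable hB
  rw [Measure.map_apply (continuous_slide v v).measurable hB, withDensity_apply _ hB',
    Measure.restrict_restrict hB', setLIntegral_abs_inner_outwardNormal hXo hXc hX hv
      (hB'.inter hΓ) inter_subset_right, Measure.restrict_apply hB]
  congr 1
  rw [image_preimage_inter]

theorem continuousOn_abs_inner_outwardNormal (hXo : IsOpen X) (hXc : Convex ℝ X)
    (hX : HasC1Boundary X) :
    ContinuousOn (fun p : Space n × Space n => ⟪outwardNormal X p.1, p.2⟫)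
      (frontier X ×ˢ univ) :=
  ((continuousOn_outwardNormal hXo hXc hX).comp continuousOn_fst fun _ hp => hp.1).inner
    continuousOn_snd

/-- Lines parallel to v that meet X are labelled either by their trace on vᗮ or by their incoming
boundary point. Fubini uses the first label and the area formula passes to the second. -/
theorem setLIntegral_eq_incomingAt (hXo : IsOpen X) (hXb : Bornology.IsBounded X) (hXc : Convex ℝ X)
    (hX : HasC1Boundary X) {v : Space n} (hv : ‖v‖ = 1) {f : Space n → ENNReal} (hf : Measurable f) :
    ∫⁻ y in X, f y = ∫⁻ x in incomingAt X v, ENNReal.ofReal |⟪outwardNormal X x, v⟫| *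
      (∫⁻ t in {t : ℝ | 0 < t ∧ x + t • v ∈ X}, f (x + t • v)) ∂μHE[n - 1] := by
  have hΓ := measurableSet_incomingAt hXo hXc hX v
  have hvv : ⟪v, v⟫ ≠ 0 := by rw [real_inner_self_eq_norm_sq, hv]; norm_num
  set F : Space n → ENNReal := X.indicator f with hF
  have hFm : Measurable F := hf.indicator hXo.measurableSet
  set h : Space n → ENNReal := fun y => ∫⁻ t : ℝ, F (y + t • v) with hh
  have hhm : Measurable h := by
    refine Measurable.lintegral_prod_right' (f := fun p : Space n × ℝ => F (p.1 + p.2 • v)) ?_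
    fun_prop
  -- The integral over a full line does not depend on the point of the line taken as origin.
  have hshift : ∀ x, h (slide v v x) = h x := by
    intro x
    simp only [hh]
    rw [← lintegral_add_right_eq_self (fun t : ℝ => F (slide v v x + t • v)) ⟪v, x⟫]
    refine lintegral_congr fun t => ?_
    rw [slide_self_apply hv, add_smul]
    congr 1
    abel
  have hinner : ∀ x ∈ incomingAt X v,
      ∫⁻ t in {t : ℝ | 0 < t ∧ x + t • v ∈ X}, f (x + t • v) = h (slide v v x) := by
    intro x hx
    have hset : {t : ℝ | 0 < t ∧ x + t • v ∈ X} = (fun t : ℝ => x + t • v) ⁻¹' X := by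
      ext t
      exact ⟨fun ht => ht.2, fun ht => ⟨pos_of_add_smul_mem hXo hXc hX hx ht, ht⟩⟩
    have hc : Continuous (fun t : ℝ => x + t • v) := by fun_prop
    rw [hshift, hset, ← lintegral_indicator (hXo.preimage hc).measurableSet]
    rfl
  have hdens : AEMeasurable (fun x => ENNReal.ofReal |⟪outwardNormal X x, v⟫|)
      (μHE[n - 1].restrict (incomingAt X v)) := by
    have hc : ContinuousOn (fun x => ⟪outwardNormal X x, v⟫) (incomingAt X v) :=
      ((continuousOn_outwardNormal hXo hXc hX).mono fun x hx => hx.1).inner continuousOn_const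
    have := hc.aemeasurable (μ := μHE[n - 1]) hΓ
    exact (measurable_norm.comp_aemeasurable this).ennreal_ofReal
  have himage : slide v v '' incomingAt X v ⊆ {y | ⟪v, y⟫ = 0} := by
    rintro _ ⟨x, -, rfl⟩
    exact inner_slide hvv x
  rw [← lintegral_indicator hXo.measurableSet, lintegral_eq_lintegral_hyperplane hv hFm,
    setLIntegral_congr_fun hΓ (g := fun x => ENNReal.ofReal |⟪outwardNormal X x, v⟫| *
      h (slide v v x)) (fun x hx => by simp only [hinner x hx])]
  have hmap := map_slide_withDensity hXo hXc hX hv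
  have h4 : ∫⁻ x in incomingAt X v, ENNReal.ofReal |⟪outwardNormal X x, v⟫| * h (slide v v x)
      ∂μHE[n - 1] = ∫⁻ y in slide v v '' incomingAt X v, h y ∂μHE[n - 1] := by
    rw [← hmap, lintegral_map hhm (continuous_slide v v).measurable]
    exact (lintegral_withDensity_eq_lintegral_mul₀ hdens
      (hhm.comp (continuous_slide v v).measurable).aemeasurable).symm
  rw [h4]
  -- A line that meets X enters it through an incoming point, so lines outside the shadow contribute
  -- nothing.
  have hzero : ∀ y ∈ {y | ⟪v, y⟫ = 0}, y ∉ slide v v '' incomingAt X v → h y = 0 := by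
    intro y hy hy'
    have hne : ∀ t : ℝ, F (y + t • v) = 0 := by
      intro t
      refine indicator_of_notMem (fun ht => hy' ?_) _
      have hex := exit_mem_incoming hXo hXb hXc hX ht hv
      refine ⟨_, ⟨hex.1, hex.2.2⟩, ?_⟩
      rw [sub_eq_add_neg, ← neg_smul, slide_add_smul hvv, slide_add_smul hvv,
        slide_self_apply hv, show ⟪v, y⟫ = 0 from hy, zero_smul, sub_zero]
    simp only [hh, hne, lintegral_zero]
  have hIm : MeasurableSet (slide v v '' incomingAt X v) :=
    hΓ.image_of_continuousOn_injOn (continuous_slide v v).continuousOn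
      (injOn_slide_incomingAt hXo hXc hX hv)
  have hHm : MeasurableSet {y : Space n | ⟪v, y⟫ = 0} :=
    (isClosed_eq (by fun_prop) continuous_const).measurableSet
  rw [← lintegral_indicator hHm, ← lintegral_indicator hIm]
  refine lintegral_congr fun y => ?_
  by_cases hy : y ∈ slide v v '' incomingAt X v
  · rw [indicator_of_mem hy, indicator_of_mem (himage hy)]
  · rw [indicator_of_notMem hy]
    by_cases hy' : y ∈ {y | ⟪v, y⟫ = 0}
    · rw [indicator_of_mem hy']; exact hzero y hy' hy
    · rw [indicator_of_notMem hy']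

instance : IsFiniteMeasure (sphereMeasure n) := by
  unfold sphereMeasure; infer_instance

theorem ae_norm_sphereMeasure : ∀ᵐ v ∂(sphereMeasure n), ‖v‖ = 1 := by
  rw [sphereMeasure, ae_map_iff measurable_subtype_coe.aemeasurable
    (isClosed_eq continuous_norm continuous_const).measurableSet]
  exact Eventually.of_forall fun v => by simp

theorem measurableSet_incoming (hXo : IsOpen X) (hXc : Convex ℝ X) (hX : HasC1Boundary X) :
    MeasurableSet (incoming X) := by
  obtain ⟨U, hU, hUeq⟩ := (_root_.continuousOn_iff'.1
    (continuousOn_abs_inner_outwardNormal hXo hXc hX)) (Iio 0) isOpen_Iio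
  have : incoming X = (U ∩ (frontier X ×ˢ univ)) ∩ (univ ×ˢ sphere 0 1) := by
    rw [← hUeq]
    ext p
    simp only [incoming, mem_ofPred_eq, mem_inter_iff, mem_preimage, mem_Iio, mem_prod, mem_univ, and_true,
      true_and]
    tauto
  rw [this]
  exact (hU.measurableSet.inter (isClosed_frontier.measurableSet.prod .univ)).inter
    (MeasurableSet.univ.prod isClosed_sphere.measurableSet)

/-- The phase space of points on rays issued from the incoming boundary. -/
def rays (X : Set (Space n)) : Set ((Space n × Space n) × ℝ) :=
  {p | 0 < p.2 ∧ p.1.1 + p.2 • p.1.2 ∈ X}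

theorem measurableSet_rays (hXo : IsOpen X) : MeasurableSet (rays X) := by
  have h1 : IsOpen {p : (Space n × Space n) × ℝ | 0 < p.2} := isOpen_lt continuous_const continuous_snd
  have h2 : IsOpen {p : (Space n × Space n) × ℝ | p.1.1 + p.2 • p.1.2 ∈ X} :=
    hXo.preimage (by fun_prop)
  exact (h1.inter h2).measurableSet

/-- The point and direction on a ray. -/
def rayPoint (p : (Space n × Space n) × ℝ) : Space n × Space n := (p.1.1 + p.2 • p.1.2, p.1.2)

theorem measurable_rayPoint : Measurable (rayPoint (n := n)) := by
  unfold rayPoint; fun_prop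

theorem aemeasurable_flux_density (hXo : IsOpen X) (hXc : Convex ℝ X) (hX : HasC1Boundary X) :
    AEMeasurable (fun p : Space n × Space n => ENNReal.ofReal |⟪outwardNormal X p.1, p.2⟫|)
      (incomingMeasure X) := by
  have hc : ContinuousOn (fun p : Space n × Space n => ⟪outwardNormal X p.1, p.2⟫) (incoming X) :=
    (continuousOn_abs_inner_outwardNormal hXo hXc hX).mono fun p hp => ⟨hp.1, mem_univ _⟩
  have := hc.aemeasurable (μ := ((Measure.euclideanHausdorffMeasure (n - 1)).restrict
    (frontier X)).prod (sphereMeasure n)) (measurableSet_incoming hXo hXc hX)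
  exact (measurable_norm.comp_aemeasurable this).ennreal_ofReal

theorem isFiniteMeasure_frontier (hXo : IsOpen X) (hXb : Bornology.IsBounded X)
    (hX : HasC1Boundary X) :
    IsFiniteMeasure ((μHE[n - 1] : Measure (Space n)).restrict (frontier X)) :=
  ⟨by simpa using euclideanHausdorffMeasure_frontier_lt_top hXo hXb hX⟩

theorem isFiniteMeasure_incomingMeasure (hXo : IsOpen X) (hXb : Bornology.IsBounded X)
    (hX : HasC1Boundary X) : IsFiniteMeasure (incomingMeasure X) := by
  have := isFiniteMeasure_frontier hXo hXb hX
  unfold incomingMeasure; infer_instance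

theorem sFinite_fluxMeasure (hXo : IsOpen X) (hXb : Bornology.IsBounded X)
    (hX : HasC1Boundary X) : SFinite (fluxMeasure X) := by
  have := isFiniteMeasure_incomingMeasure hXo hXb hX
  unfold fluxMeasure; infer_instance

/-- Phase space is foliated by the rays issued from the incoming boundary. -/
theorem map_rayPoint (hXo : IsOpen X) (hXb : Bornology.IsBounded X) (hXc : Convex ℝ X)
    (hX : HasC1Boundary X) :
    (((fluxMeasure X).prod volume).restrict (rays X)).map rayPoint =
      ((volume : Measure (Space n)).restrict X).prod (sphereMeasure n) := by
  have := isFiniteMeasure_frontier hXo hXb hX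
  have := isFiniteMeasure_incomingMeasure hXo hXb hX
  have := sFinite_fluxMeasure hXo hXb hX
  refine Measure.ext_of_lintegral _ fun f hf => ?_
  set f' : (Space n × Space n) × ℝ → ENNReal := (rays X).indicator (f ∘ rayPoint) with hf'
  have hfm' : Measurable f' := (hf.comp measurable_rayPoint).indicator (measurableSet_rays hXo)
  set g : Space n × Space n → ENNReal := fun p => ∫⁻ t : ℝ, f' (p, t) with hg
  have hgm : Measurable g := hfm'.lintegral_prod_right'
  have hinc := measurableSet_incoming hXo hXc hX
  have hd := aemeasurable_flux_density hXo hXc hX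
  rw [lintegral_map hf measurable_rayPoint, ← lintegral_indicator (measurableSet_rays hXo)]
  change ∫⁻ p, f' p ∂_ = _
  rw [lintegral_prod _ hfm'.aemeasurable, fluxMeasure,
    lintegral_withDensity_eq_lintegral_mul₀ hd hgm.aemeasurable, incomingMeasure,
    ← lintegral_indicator hinc, lintegral_prod_symm, lintegral_prod_symm _ hf.aemeasurable]
  -- With the direction integrated last on both sides, the identity reduces to the foliation of X by
  -- parallel lines.
  · refine lintegral_congr_ae (ae_norm_sphereMeasure.mono fun v hv => ?_)
    have hΓ := measurableSet_incomingAt hXo hXc hX v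
    have hfv : Measurable fun y => f (y, v) := by fun_prop
    simp only
    rw [setLIntegral_eq_incomingAt hXo hXb hXc hX hv hfv, ← lintegral_indicator hΓ,
      ← lintegral_indicator isClosed_frontier.measurableSet]
    refine lintegral_congr fun x => ?_
    have hmem : (x, v) ∈ incoming X ↔ x ∈ incomingAt X v := by
      simp [incoming, incomingAt, hv]
    by_cases hx : x ∈ incomingAt X v
    · rw [indicator_of_mem hx.1, indicator_of_mem (hmem.2 hx), indicator_of_mem hx]
      simp only [Pi.mul_apply]
      congr 1
      have hmt : MeasurableSet {t : ℝ | 0 < t ∧ x + t • v ∈ X} :=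
        (measurable_prodMk_left (x := (x, v))) (measurableSet_rays hXo)
      rw [← lintegral_indicator hmt]
      rfl
    · rw [indicator_of_notMem hx]
      by_cases hx' : x ∈ frontier X
      · rw [indicator_of_mem hx', indicator_of_notMem (hmem.not.2 hx)]
      · rw [indicator_of_notMem hx']
  · rw [aemeasurable_indicator_iff hinc]
    exact hd.mul hgm.aemeasurable

end Disintegration

end Photoacoustic

namespace Photoacoustic

/-! ### Measurability, bounds and locality of the coefficients -/

section Coefficients

variable {n : ℕ} {X : Set (Space n)} {σ : Space n → Space n → ℝ}
  {k : Space n → Space n → Space n → ℝ}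

theorem measurable_sigmaA (hσ : Measurable fun p : Space n × Space n => σ p.1 p.2)
    (hk : Measurable fun p : Space n × Space n × Space n => k p.1 p.2.1 p.2.2) :
    Measurable fun p : Space n × Space n => sigmaA σ k p.1 p.2 := by
  refine hσ.sub ?_
  have h : StronglyMeasurable fun p : (Space n × Space n) × Space n => k p.1.1 p.1.2 p.2 :=
    (hk.comp (g := fun p : Space n × Space n × Space n => k p.1 p.2.1 p.2.2)
      (f := fun p : (Space n × Space n) × Space n => (p.1.1, p.1.2, p.2))
      (by fun_prop)).stronglyMeasurable
  exact (h.integral_prod_right' (ν := sphereMeasure n)).measurable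

theorem abs_sigmaA_le {M N : ℝ} (hσ : ∀ x v, |σ x v| ≤ M) (hk : ∀ x v w, |k x v w| ≤ N)
    (x v : Space n) : |sigmaA σ k x v| ≤ M + N * (sphereMeasure n).real univ := by
  refine (abs_sub _ _).trans (add_le_add (hσ x v) ?_)
  exact norm_integral_le_of_norm_le_const (Eventually.of_forall fun w =>
    (Real.norm_eq_abs _).trans_le (hk x v w))

theorem measurable_direction : Measurable fun p : Space n × Space n => direction p.1 p.2 := by
  unfold direction; fun_prop

theorem norm_direction {x y : Space n} (h : x ≠ y) : ‖direction x y‖ = 1 := by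
  rw [direction, norm_smul, norm_inv, norm_norm,
    inv_mul_cancel₀ (norm_ne_zero_iff.2 (sub_ne_zero.2 h))]

theorem direction_sub_smul {x v : Space n} (hv : ‖v‖ = 1) {t : ℝ} (ht : 0 < t) :
    direction x (x - t • v) = v := by
  rw [direction, sub_sub_cancel, norm_smul, hv, mul_one, Real.norm_eq_abs, abs_of_pos ht,
    smul_smul, inv_mul_cancel₀ ht.ne', one_smul]

theorem norm_sub_sub_smul {x v : Space n} (hv : ‖v‖ = 1) {t : ℝ} (ht : 0 ≤ t) :
    ‖x - (x - t • v)‖ = t := by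
  rw [sub_sub_cancel, norm_smul, hv, mul_one, Real.norm_eq_abs, abs_of_nonneg ht]

theorem attenuation_sub_smul {x v : Space n} (hv : ‖v‖ = 1) {t : ℝ} (ht : 0 ≤ t) :
    attenuation σ x (x - t • v) = Real.exp (-∫ s in (0 : ℝ)..t, σ (x - s • v) v) := by
  rcases ht.eq_or_lt with rfl | ht'
  · simp [attenuation]
  · rw [attenuation, direction_sub_smul hv ht', norm_sub_sub_smul hv ht]

/-- The variable endpoint is absorbed into an indicator over a measurable set, which leaves a
parametric integral over all of ℝ. -/
theorem measurable_attenuation (hσ : Measurable fun p : Space n × Space n => σ p.1 p.2) :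
    Measurable fun p : Space n × Space n => attenuation σ p.1 p.2 := by
  set S : Set ((Space n × Space n) × ℝ) := {q | 0 < q.2 ∧ q.2 ≤ ‖q.1.1 - q.1.2‖} with hS
  have hSm : MeasurableSet S :=
    (measurableSet_lt measurable_const measurable_snd).inter
      (measurableSet_le measurable_snd (by fun_prop))
  have hd : Measurable fun q : (Space n × Space n) × ℝ => direction q.1.1 q.1.2 :=
    measurable_direction.comp measurable_fst
  have hF : StronglyMeasurable (S.indicator fun q : (Space n × Space n) × ℝ =>
      σ (q.1.1 - q.2 • direction q.1.1 q.1.2) (direction q.1.1 q.1.2)) :=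
    ((hσ.comp (g := fun p : Space n × Space n => σ p.1 p.2)
      ((measurable_fst.fst.sub (measurable_snd.smul hd)).prodMk hd)).indicator
        hSm).stronglyMeasurable
  have hI := (hF.integral_prod_right' (ν := (volume : Measure ℝ))).measurable
  convert Real.measurable_exp.comp hI.neg using 1
  funext p
  simp only [Function.comp_apply, attenuation, Pi.neg_apply]
  congr 2
  rw [intervalIntegral.integral_of_le (norm_nonneg _), ← integral_indicator measurableSet_Ioc]
  rfl

theorem attenuation_pos (x y : Space n) : 0 < attenuation σ x y := Real.exp_pos _

theorem attenuation_le {M : ℝ} (hσ : ∀ x v, |σ x v| ≤ M) (x y : Space n) :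
    attenuation σ x y ≤ Real.exp (M * ‖x - y‖) := by
  refine Real.exp_le_exp.2 ((neg_le_abs _).trans ?_)
  refine (intervalIntegral.norm_integral_le_of_norm_le_const (C := M) fun s _ =>
    (Real.norm_eq_abs _).trans_le (hσ _ _)).trans ?_
  rw [sub_zero, abs_of_nonneg (norm_nonneg _)]

/-- The boundary point, with its direction, from which the ray through `q` was issued. -/
noncomputable def entry (X : Set (Space n)) (q : Space n × Space n) : Space n × Space n :=
  (q.1 - tauMinus X q.1 q.2 • q.2, q.2)

theorem ballistic_eq {φ : Space n × Space n → ℝ} {y v : Space n} (hv : ‖v‖ = 1) :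
    ballistic X σ φ y v = attenuation σ y (entry X (y, v)).1 * φ (entry X (y, v)) := by
  rw [ballistic, entry, attenuation_sub_smul hv (tauMinus_nonneg y v)]

/-! ### Dependence on the coefficients inside the domain only -/

variable {σ' : Space n → Space n → ℝ} {k' : Space n → Space n → Space n → ℝ}

theorem sigmaA_congr (hσ : ∀ x ∈ X, ∀ v, ‖v‖ = 1 → σ x v = σ' x v)
    (hk : ∀ x ∈ X, ∀ v w, ‖v‖ = 1 → ‖w‖ = 1 → k x v w = k' x v w) {x v : Space n}
    (hx : x ∈ X) (hv : ‖v‖ = 1) : sigmaA σ k x v = sigmaA σ' k' x v := by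
  rw [sigmaA, sigmaA, hσ x hx v hv, sigmaS, sigmaS]
  congr 1
  exact integral_congr_ae (ae_norm_sphereMeasure.mono fun w hw => hk x hx v w hv hw)

theorem attenuation_congr (hσ : ∀ x ∈ X, ∀ v, ‖v‖ = 1 → σ x v = σ' x v) {x y : Space n}
    (hseg : ∀ s ∈ Ioo 0 ‖x - y‖, x - s • direction x y ∈ X) :
    attenuation σ x y = attenuation σ' x y := by
  rw [attenuation, attenuation]
  congr 2
  rcases eq_or_ne x y with rfl | hne
  · simp
  rw [intervalIntegral.integral_of_le (norm_nonneg _), intervalIntegral.integral_of_le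
    (norm_nonneg _), integral_Ioc_eq_integral_Ioo, integral_Ioc_eq_integral_Ioo]
  exact setIntegral_congr_fun measurableSet_Ioo fun s hs =>
    hσ _ (hseg s hs) _ (norm_direction hne)

theorem sub_smul_direction_mem (hXc : Convex ℝ X) {x y : Space n} (hx : x ∈ X) (hy : y ∈ X)
    {s : ℝ} (hs : s ∈ Ioo 0 ‖x - y‖) : x - s • direction x y ∈ X := by
  have hpos : 0 < ‖x - y‖ := hs.1.trans hs.2
  have h1 : s / ‖x - y‖ ≤ 1 := (div_le_one hpos).2 hs.2.le
  have := hXc hx hy (a := 1 - s / ‖x - y‖) (b := s / ‖x - y‖) (by linarith)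
    (div_nonneg hs.1.le hpos.le) (by ring)
  convert this using 1
  rw [direction, smul_smul, ← div_eq_mul_inv]
  module

theorem attenuation_congr_of_mem (hXc : Convex ℝ X)
    (hσ : ∀ x ∈ X, ∀ v, ‖v‖ = 1 → σ x v = σ' x v) {x y : Space n} (hx : x ∈ X) (hy : y ∈ X) :
    attenuation σ x y = attenuation σ' x y :=
  attenuation_congr hσ fun _ hs => sub_smul_direction_mem hXc hx hy hs

theorem attenuation_congr_ray (hXo : IsOpen X) (hXb : Bornology.IsBounded X) (hXc : Convex ℝ X)
    (hσ : ∀ x ∈ X, ∀ v, ‖v‖ = 1 → σ x v = σ' x v) {x v : Space n} (hx : x ∈ X) (hv : ‖v‖ = 1)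
    {t : ℝ} (ht : 0 ≤ t) (htτ : t ≤ tauMinus X x v) :
    attenuation σ x (x - t • v) = attenuation σ' x (x - t • v) := by
  rcases ht.eq_or_lt with rfl | ht0
  · simp [attenuation]
  refine attenuation_congr hσ fun s hs => ?_
  rw [direction_sub_smul hv ht0]
  rw [norm_sub_sub_smul hv ht] at hs
  exact (sub_smul_mem_iff hXo hXb hXc (subset_closure hx) hv hs.1).2 (hs.2.trans_le htτ)

theorem ballistic_congr (hXo : IsOpen X) (hXb : Bornology.IsBounded X) (hXc : Convex ℝ X)
    (hσ : ∀ x ∈ X, ∀ v, ‖v‖ = 1 → σ x v = σ' x v) {φ : Space n × Space n → ℝ} {x v : Space n}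
    (hx : x ∈ X) (hv : ‖v‖ = 1) : ballistic X σ φ x v = ballistic X σ' φ x v := by
  rw [ballistic_eq hv, ballistic_eq hv, entry, attenuation_congr_ray hXo hXb hXc hσ hx hv
    (tauMinus_nonneg x v) le_rfl]

theorem albedoOne_congr (hXo : IsOpen X) (hXb : Bornology.IsBounded X) (hXc : Convex ℝ X)
    (hσ : ∀ x ∈ X, ∀ v, ‖v‖ = 1 → σ x v = σ' x v)
    (hk : ∀ x ∈ X, ∀ v w, ‖v‖ = 1 → ‖w‖ = 1 → k x v w = k' x v w)
    {φ : Space n × Space n → ℝ} {x : Space n} (hx : x ∈ X) :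
    albedoOne X σ k φ x = albedoOne X σ' k' φ x := by
  refine integral_congr_ae (ae_norm_sphereMeasure.mono fun v hv => ?_)
  beta_reduce
  rw [sigmaA_congr hσ hk hx hv, scatter, scatter, intervalIntegral.integral_of_le
    (tauMinus_nonneg x v), intervalIntegral.integral_of_le (tauMinus_nonneg x v),
    integral_Ioc_eq_integral_Ioo, integral_Ioc_eq_integral_Ioo]
  congr 1
  refine setIntegral_congr_fun measurableSet_Ioo fun t ht => ?_
  have hmem := (sub_smul_mem_iff hXo hXb hXc (subset_closure hx) hv ht.1).2 ht.2
  rw [attenuation_congr_of_mem hXc hσ hx hmem]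
  congr 1
  refine integral_congr_ae (ae_norm_sphereMeasure.mono fun w hw => ?_)
  beta_reduce
  rw [hk _ hmem w v hw hv, ballistic_congr hXo hXb hXc hσ hmem hw]

theorem attenuation_congr_incoming (hXo : IsOpen X) (hXb : Bornology.IsBounded X)
    (hXc : Convex ℝ X) (hσ : ∀ x ∈ X, ∀ v, ‖v‖ = 1 → σ x v = σ' x v) {x v : Space n}
    (hx : x ∈ frontier X) (hv : ‖v‖ = 1) {t : ℝ} (ht : t ∈ Ioo 0 (tauPlus X x v)) :
    attenuation σ (x + t • v) x = attenuation σ' (x + t • v) x := by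
  have hmem := (add_smul_mem_iff hXo hXb hXc (frontier_subset_closure hx) hv ht.1).2 ht.2
  have := attenuation_congr_ray hXo hXb hXc hσ hmem hv ht.1.le
    (tauMinus_add_smul hXo hXb hXc hx hv ht.1 hmem).ge
  rwa [add_sub_cancel_right] at this

/-- All segments involved run inside X, so only the values of σ and k on X at unit directions enter.
This permits replacing the coefficients by globally measurable ones. -/
theorem alphaOne_congr (hn : 2 ≤ n) (hXo : IsOpen X) (hXb : Bornology.IsBounded X)
    (hXc : Convex ℝ X) (hσ : ∀ x ∈ X, ∀ v, ‖v‖ = 1 → σ x v = σ' x v)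
    (hk : ∀ x ∈ X, ∀ v w, ‖v‖ = 1 → ‖w‖ = 1 → k x v w = k' x v w)
    {x x' v' : Space n} (hx : x ∈ X) (hx' : (x', v') ∈ incoming X) :
    alphaOne X σ k x x' v' = alphaOne X σ' k' x x' v' := by
  have hv' : ‖v'‖ = 1 := by simpa using hx'.2.1
  rw [alphaOne, alphaOne, intervalIntegral.integral_of_le (tauPlus_nonneg x' v'),
    intervalIntegral.integral_of_le (tauPlus_nonneg x' v'),
    integral_Ioc_eq_integral_Ioo, integral_Ioc_eq_integral_Ioo]
  congr 1
  refine setIntegral_congr_fun measurableSet_Ioo fun t ht => ?_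
  have hmem := (add_smul_mem_iff hXo hXb hXc (frontier_subset_closure hx'.1) hv' ht.1).2 ht.2
  rcases eq_or_ne x (x' + t • v') with heq | hne
  -- When the scattering point is x itself, `direction` is 0 rather than a unit vector and the
  -- coefficients need not agree; division by zero gives 0 on both sides since n - 1 > 0.
  · have h0 : ‖x - x' - t • v'‖ ^ (n - 1) = 0 := by
      rw [heq, add_sub_cancel_left, sub_self, norm_zero, zero_pow (by omega)]
    simp only [h0, div_zero, mul_zero, zero_mul]
  · have hd := norm_direction hne
    rw [sigmaA_congr hσ hk hx hd, attenuation_congr_of_mem hXc hσ hx hmem,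
      attenuation_congr_incoming hXo hXb hXc hσ hx'.1 hv' ht, hk _ hmem _ _ hv' hd]

end Coefficients

end Photoacoustic

namespace Photoacoustic

/-! ### The entry map, the singular kernel and polar coordinates -/

section Integrability

variable {n : ℕ} {X : Set (Space n)}

theorem ae_fluxMeasure_mem_incoming (hXo : IsOpen X) (hXc : Convex ℝ X) (hX : HasC1Boundary X) :
    ∀ᵐ p ∂(fluxMeasure X), p ∈ incoming X :=
  (withDensity_absolutelyContinuous _ _).ae_le
    (ae_restrict_mem (measurableSet_incoming hXo hXc hX))

theorem ae_rays (hXo : IsOpen X) (hXb : Bornology.IsBounded X) (hXc : Convex ℝ X)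
    (hX : HasC1Boundary X) :
    ∀ᵐ p ∂(((fluxMeasure X).prod (volume : Measure ℝ)).restrict (rays X)),
      p.1 ∈ incoming X ∧ p ∈ rays X := by
  have := sFinite_fluxMeasure hXo hXb hX
  have h1 : ∀ᵐ p ∂((fluxMeasure X).prod (volume : Measure ℝ)), p.1 ∈ incoming X :=
    Measure.quasiMeasurePreserving_fst.ae (ae_fluxMeasure_mem_incoming hXo hXc hX)
  filter_upwards [ae_restrict_of_ae h1, ae_restrict_mem (measurableSet_rays hXo)] with p h1 h2
    using ⟨h1, h2⟩

theorem ae_phase (hXo : IsOpen X) :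
    ∀ᵐ q ∂(((volume : Measure (Space n)).restrict X).prod (sphereMeasure n)),
      q.1 ∈ X ∧ ‖q.2‖ = 1 :=
  (Measure.quasiMeasurePreserving_fst.ae (ae_restrict_mem hXo.measurableSet)).and
    (Measure.quasiMeasurePreserving_snd.ae ae_norm_sphereMeasure)

theorem entry_rayPoint (hXo : IsOpen X) (hXb : Bornology.IsBounded X) (hXc : Convex ℝ X)
    {p : (Space n × Space n) × ℝ} (hp : p.1 ∈ incoming X) (hr : p ∈ rays X) :
    entry X (rayPoint p) = p.1 := by
  have hv : ‖p.1.2‖ = 1 := by simpa using hp.2.1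
  rw [entry, rayPoint, tauMinus_add_smul hXo hXb hXc hp.1 hv hr.1 hr.2, add_sub_cancel_right]

/-- On X × 𝕊ⁿ⁻¹ the condition τ₋ > s, for s ≥ 0, says that q.1 - s q.2 ∈ X, which is measurable in
q. -/
theorem aemeasurable_entry (hXo : IsOpen X) (hXb : Bornology.IsBounded X) (hXc : Convex ℝ X) :
    AEMeasurable (entry X)
      (((volume : Measure (Space n)).restrict X).prod (sphereMeasure n)) := by
  set S : Set (Space n × Space n) := X ×ˢ sphere 0 1 with hS
  have hSm : MeasurableSet S := hXo.measurableSet.prod isClosed_sphere.measurableSet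
  have hτ : Measurable (S.indicator fun q => tauMinus X q.1 q.2) := by
    refine measurable_of_Ioi fun s => ?_
    rcases lt_or_ge s 0 with hs | hs
    · convert MeasurableSet.univ
      refine eq_univ_of_forall fun q => hs.trans_le ?_
      exact indicator_nonneg (fun q _ => tauMinus_nonneg _ _) q
    · have : (S.indicator fun q => tauMinus X q.1 q.2) ⁻¹' Ioi s =
          S ∩ {q | q.1 - s • q.2 ∈ X} := by
        ext q
        by_cases hq : q ∈ S
        · have hv : ‖q.2‖ = 1 := by simpa using hq.2
          simp only [mem_preimage, indicator_of_mem hq, mem_Ioi, mem_inter_iff, hq, true_and,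
            mem_ofPred_eq]
          rcases hs.eq_or_lt with rfl | hs
          · simp only [zero_smul, sub_zero]
            exact ⟨fun _ => hq.1, fun _ => tauMinus_pos hXo hXb hXc hq.1 hv⟩
          · exact (sub_smul_mem_iff hXo hXb hXc (subset_closure hq.1) hv hs).symm
        · simp [hq, not_lt.2 hs]
      rw [this]
      have hm : Measurable fun q : Space n × Space n => q.1 - s • q.2 := by fun_prop
      exact hSm.inter (hm hXo.measurableSet)
  refine ⟨fun q => (q.1 - S.indicator (fun q => tauMinus X q.1 q.2) q • q.2, q.2),
    (measurable_fst.sub (hτ.smul measurable_snd)).prodMk measurable_snd, ?_⟩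
  filter_upwards [ae_phase hXo] with q hq
  have : q ∈ S := ⟨hq.1, by simpa using hq.2⟩
  simp only [entry, indicator_of_mem this]

/-- In ray coordinates `entry` is the first projection. Hence φ, which is only almost everywhere
strongly measurable for dξ, may be composed with it. -/
theorem map_entry_absolutelyContinuous (hXo : IsOpen X) (hXb : Bornology.IsBounded X)
    (hXc : Convex ℝ X) (hX : HasC1Boundary X) :
    (((volume : Measure (Space n)).restrict X).prod (sphereMeasure n)).map (entry X) ≪
      fluxMeasure X := by
  have := sFinite_fluxMeasure hXo hXb hX
  have h := aemeasurable_entry hXo hXb hXc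
  rw [← map_rayPoint hXo hXb hXc hX] at h ⊢
  rw [AEMeasurable.map_map_of_aemeasurable h measurable_rayPoint.aemeasurable,
    Measure.map_congr (f := entry X ∘ rayPoint) (g := Prod.fst) ((ae_rays hXo hXb hXc hX).mono fun p hp =>
      entry_rayPoint hXo hXb hXc hp.1 hp.2)]
  exact (Measure.restrict_le_self.absolutelyContinuous.map measurable_fst).trans
    Measure.quasiMeasurePreserving_fst.absolutelyContinuous

theorem aestronglyMeasurable_comp_entry (hXo : IsOpen X) (hXb : Bornology.IsBounded X)
    (hXc : Convex ℝ X) (hX : HasC1Boundary X) {φ : Space n × Space n → ℝ}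
    (hφ : AEStronglyMeasurable φ (fluxMeasure X)) :
    AEStronglyMeasurable (fun q => φ (entry X q))
      (((volume : Measure (Space n)).restrict X).prod (sphereMeasure n)) :=
  (hφ.mono_ac (map_entry_absolutelyContinuous hXo hXb hXc hX)).comp_aemeasurable
    (aemeasurable_entry hXo hXb hXc)

/-- In ray coordinates the function is constant along each ray, and rays have length at most the
diameter of the closure of X. -/
theorem integrable_comp_entry (hXo : IsOpen X) (hXb : Bornology.IsBounded X)
    (hXc : Convex ℝ X) (hX : HasC1Boundary X) {φ : Space n × Space n → ℝ}
    (hφ : Integrable φ (fluxMeasure X)) :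
    Integrable (fun q => φ (entry X q))
      (((volume : Measure (Space n)).restrict X).prod (sphereMeasure n)) := by
  have := sFinite_fluxMeasure hXo hXb hX
  have hm := aestronglyMeasurable_comp_entry hXo hXb hXc hX hφ.1
  rw [← map_rayPoint hXo hXb hXc hX] at hm ⊢
  rw [integrable_map_measure hm measurable_rayPoint.aemeasurable]
  have hcongr : (fun p : (Space n × Space n) × ℝ => φ p.1)
      =ᵐ[((fluxMeasure X).prod volume).restrict (rays X)] (fun q => φ (entry X q)) ∘ rayPoint :=
    (ae_rays hXo hXb hXc hX).mono fun p hp => by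
      simp only [Function.comp_apply, entry_rayPoint hXo hXb hXc hp.1 hp.2]
  refine Integrable.congr ?_ hcongr
  set D := diam (closure X) with hD
  have hint : Integrable (fun p : (Space n × Space n) × ℝ => φ p.1)
      ((fluxMeasure X).prod (volume.restrict (Ioc 0 D))) := hφ.comp_fst _
  have hres : (fluxMeasure X).prod ((volume : Measure ℝ).restrict (Ioc 0 D)) =
      ((fluxMeasure X).prod volume).restrict (univ ×ˢ Ioc 0 D) := by
    rw [← Measure.prod_restrict, Measure.restrict_univ]
  rw [hres] at hint
  refine hint.mono_measure ?_
  refine Measure.restrict_mono_ae ?_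
  have h1 : ∀ᵐ p ∂((fluxMeasure X).prod (volume : Measure ℝ)), p.1 ∈ incoming X :=
    Measure.quasiMeasurePreserving_fst.ae (ae_fluxMeasure_mem_incoming hXo hXc hX)
  filter_upwards [h1] with p hp hr
  have hv : ‖p.1.2‖ = 1 := by simpa using hp.2.1
  have hcl := frontier_subset_closure hp.1
  refine ⟨mem_univ _, hr.1, ?_⟩
  exact ((add_smul_mem_iff hXo hXb hXc hcl hv hr.1).1 hr.2).le.trans
    (tauPlus_le_diam hXo hXb hXc hcl hv)

theorem integrableOn_inv_norm_pow (hn : 2 ≤ n) (R : ℝ) :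
    IntegrableOn (fun z : Space n => (‖z‖ ^ (n - 1))⁻¹) (ball 0 R) := by
  have : Nonempty (Fin n) := ⟨⟨0, by omega⟩⟩
  rw [integrableOn_fun_norm_addHaar volume (f := fun r : ℝ => (r ^ (n - 1))⁻¹),
    finrank_euclideanSpace_fin]
  -- The polar Jacobian r^(n-1) cancels the singularity exactly.
  refine IntegrableOn.congr_fun (f := fun _ => (1 : ℝ)) (by simp) (fun r hr => ?_)
    measurableSet_Ioo
  rw [smul_eq_mul, mul_inv_cancel₀ (pow_ne_zero _ hr.1.ne')]

/-- Tonelli with x integrated first: the singular factor has integral over X bounded by C, uniformly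
in the scattering point, so the double integral is at most C times the norm of ψ. -/
theorem ae_integrable_singular (hn : 2 ≤ n) (hXo : IsOpen X) (hXb : Bornology.IsBounded X)
    {ψ : Space n × Space n → ℝ}
    (hψ : Integrable ψ (((volume : Measure (Space n)).restrict X).prod (sphereMeasure n))) :
    ∀ᵐ x ∂((volume : Measure (Space n)).restrict X),
      Integrable (fun q : Space n × Space n => (‖x - q.1‖ ^ (n - 1))⁻¹ * ψ q)
        (((volume : Measure (Space n)).restrict X).prod (sphereMeasure n)) := by
  -- The extra 1 puts X inside the open ball of radius D about each of its points.
  set D := diam X + 1 with hD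
  set C := ∫ z in ball (0 : Space n) D, (‖z‖ ^ (n - 1))⁻¹ with hC
  have hball : ∀ y : Space n, IntegrableOn (fun x : Space n => (‖x - y‖ ^ (n - 1))⁻¹)
      (ball y D) ∧ ∫ x in ball y D, (‖x - y‖ ^ (n - 1))⁻¹ = C := by
    intro y
    have hmp := measurePreserving_sub_right (volume : Measure (Space n)) y
    have hemb : MeasurableEmbedding fun x : Space n => x - y :=
      (MeasurableEquiv.subRight y).measurableEmbedding
    have hpre : (fun x : Space n => x - y) ⁻¹' ball 0 D = ball y D := by
      ext x; simp [dist_eq_norm]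
    rw [← hpre]
    exact ⟨(hmp.integrableOn_comp_preimage hemb).2 (integrableOn_inv_norm_pow hn D),
      hmp.setIntegral_preimage_emb hemb (fun z => (‖z‖ ^ (n - 1))⁻¹) _⟩
  have hsub : ∀ y ∈ X, X ⊆ ball y D := fun y hy x hx => by
    rw [mem_ball]; have := dist_le_diam_of_mem hXb hx hy; linarith
  have hK : Measurable fun p : Space n × Space n × Space n => (‖p.1 - p.2.1‖ ^ (n - 1))⁻¹ := by
    fun_prop
  have hF : AEStronglyMeasurable
      (fun p : Space n × Space n × Space n => (‖p.1 - p.2.1‖ ^ (n - 1))⁻¹ * ψ p.2)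
      (((volume : Measure (Space n)).restrict X).prod
        (((volume : Measure (Space n)).restrict X).prod (sphereMeasure n))) :=
    hK.aestronglyMeasurable.mul hψ.1.comp_snd
  refine Integrable.prod_right_ae
    (f := fun p : Space n × Space n × Space n => (‖p.1 - p.2.1‖ ^ (n - 1))⁻¹ * ψ p.2) ?_
  rw [integrable_prod_iff' hF]
  refine ⟨?_, ?_⟩
  · filter_upwards [ae_phase hXo] with q hq
    exact ((hball q.1).1.mono_set (hsub q.1 hq.1)).mul_const _
  · refine (hψ.norm.const_mul C).mono' ?_ ?_
    · exact hF.norm.prod_swap.integral_prod_right'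
    · filter_upwards [ae_phase hXo] with q hq
      simp only [norm_mul]
      rw [integral_mul_const, norm_mul, norm_norm]
      refine mul_le_mul_of_nonneg_right ?_ (norm_nonneg _)
      rw [Real.norm_of_nonneg (integral_nonneg fun _ => norm_nonneg _), ← (hball q.1).2]
      have hnn : ∀ x : Space n, ‖(‖x - q.1‖ ^ (n - 1))⁻¹‖ = (‖x - q.1‖ ^ (n - 1))⁻¹ := fun x =>
        Real.norm_of_nonneg (by positivity)
      simp only [hnn]
      exact setIntegral_mono_set (hball q.1).1 (Eventually.of_forall fun x => by positivity)
        (LE.le.eventuallyLE (hsub q.1 hq.1))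

/-- Integration over `X` in polar coordinates centred at a point of `X`. -/
theorem setIntegral_eq_polar (hn : 2 ≤ n) (hXo : IsOpen X) (hXb : Bornology.IsBounded X)
    (hXc : Convex ℝ X) {g : Space n → ℝ} (hg : IntegrableOn g X) {x : Space n} (hx : x ∈ X) :
    ∫ y in X, g y = ∫ v, (∫ t in (0 : ℝ)..tauMinus X x v, t ^ (n - 1) * g (x - t • v))
      ∂(sphereMeasure n) := by
  have : Nonempty (Fin n) := ⟨⟨0, by omega⟩⟩
  -- Reflecting through x makes the polar ray in direction v run along x - tv, to match `tauMinus`.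
  set f : Space n → ℝ := fun z => X.indicator g (x - z) with hf
  have hfi : Integrable f := ((integrable_indicator_iff hXo.measurableSet).2 hg).comp_sub_left x
  have hmp := (volume : Measure (Space n)).measurePreserving_homeomorphUnitSphereProd
  have hemb := (homeomorphUnitSphereProd (Space n)).measurableEmbedding
  rw [finrank_euclideanSpace_fin] at hmp
  set F : sphere (0 : Space n) 1 × Ioi (0 : ℝ) → ℝ := fun p => f (p.2.1 • p.1.1) with hF
  have hFcomp : F ∘ homeomorphUnitSphereProd (Space n) = fun z => f z.1 := by
    funext z
    have h0 : ‖z.1‖ ≠ 0 := norm_ne_zero_iff.2 z.2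
    simp only [hF, Function.comp_apply, homeomorphUnitSphereProd_apply_snd_coe,
      homeomorphUnitSphereProd_apply_fst_coe]
    rw [smul_smul, mul_inv_cancel₀ h0, one_smul]
  have hcompl : MeasurableSet ({0}ᶜ : Set (Space n)) := (measurableSet_singleton _).compl
  have hFi : Integrable F ((volume : Measure (Space n)).toSphere.prod
      (Measure.volumeIoiPow (n - 1))) := by
    rw [← hmp.integrable_comp_emb hemb, hFcomp]
    exact (integrableOn_iff_comap_subtypeVal hcompl).1 hfi.integrableOn
  have h1 : ∫ y in X, g y = ∫ z, f z := by
    rw [hf, integral_sub_left_eq_self (fun z => X.indicator g z), integral_indicator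
      hXo.measurableSet]
  have h2 : ∫ z, f z = ∫ p, F p ∂((volume : Measure (Space n)).toSphere.prod
      (Measure.volumeIoiPow (n - 1))) := by
    rw [← hmp.integral_comp hemb]
    change _ = ∫ z, (F ∘ homeomorphUnitSphereProd (Space n)) z ∂_
    rw [hFcomp, integral_subtype_comap hcompl, restrict_compl_singleton]
  rw [h1, h2, integral_prod _ hFi, sphereMeasure,
    (MeasurableEmbedding.subtype_coe isClosed_sphere.measurableSet).integral_map]
  refine integral_congr_ae (Eventually.of_forall fun v => ?_)
  have hv : ‖(v : Space n)‖ = 1 := by simp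
  simp only [hF, Measure.volumeIoiPow, ENNReal.ofReal]
  rw [integral_withDensity_eq_integral_smul
      (by exact (measurable_subtype_coe.pow_const _).real_toNNReal),
    integral_subtype_comap measurableSet_Ioi
      fun r : ℝ => Real.toNNReal (r ^ (n - 1)) • f (r • (v : Space n)),
    intervalIntegral.integral_of_le (tauMinus_nonneg _ _), integral_Ioc_eq_integral_Ioo,
    ← integral_indicator measurableSet_Ioi, ← integral_indicator measurableSet_Ioo]
  refine integral_congr_ae (Eventually.of_forall fun r => ?_)
  by_cases hr : 0 < r
  · rw [indicator_of_mem (mem_Ioi.2 hr), NNReal.smul_def, Real.coe_toNNReal _ (by positivity),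
      hf, smul_eq_mul]
    beta_reduce
    have hiff := sub_smul_mem_iff hXo hXb hXc (subset_closure hx) hv hr
    by_cases hr2 : r < tauMinus X x v
    · rw [indicator_of_mem (hiff.2 hr2), indicator_of_mem (show r ∈ Ioo _ _ from ⟨hr, hr2⟩)]
    · rw [indicator_of_notMem (hiff.not.2 hr2), indicator_of_notMem (fun h => hr2 h.2), mul_zero]
  · rw [indicator_of_notMem (notMem_Ioi.2 (not_lt.1 hr)), indicator_of_notMem (fun h => hr h.1)]

end Integrability

end Photoacoustic

namespace Photoacoustic

/-! ### The Schwartz kernel of the single scattering operator -/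

section Kernel

variable {n : ℕ} {X : Set (Space n)} {σ : Space n → Space n → ℝ}
  {k : Space n → Space n → Space n → ℝ}

/-- The integrand of `A₁φ(x)` over the phase space of scattering events. -/
noncomputable def scatterDensity (X : Set (Space n)) (σ : Space n → Space n → ℝ)
    (k : Space n → Space n → Space n → ℝ) (φ : Space n × Space n → ℝ) (x : Space n)
    (q : Space n × Space n) : ℝ :=
  sigmaA σ k x (direction x q.1) * (attenuation σ x q.1 * (‖x - q.1‖ ^ (n - 1))⁻¹) *
    (k q.1 q.2 (direction x q.1) * ballistic X σ φ q.1 q.2)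

/-- The integrand of `α₁(x, x', v')`, without the factor `|ν(x') · v'|`. -/
noncomputable def kernelDensity (σ : Space n → Space n → ℝ)
    (k : Space n → Space n → Space n → ℝ) (x x' v' : Space n) (t : ℝ) : ℝ :=
  sigmaA σ k x (direction x (x' + t • v')) *
    (attenuation σ x (x' + t • v') * attenuation σ (x' + t • v') x' /
      ‖x - x' - t • v'‖ ^ (n - 1)) * k (x' + t • v') v' (direction x (x' + t • v'))

theorem entry_fst_mem_closure (hXo : IsOpen X) (hXb : Bornology.IsBounded X) (hXc : Convex ℝ X)
    {q : Space n × Space n} (hq : q.1 ∈ X) (hv : ‖q.2‖ = 1) : (entry X q).1 ∈ closure X := by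
  have hpos := tauMinus_pos hXo hXb hXc hq hv
  have hc : Continuous (fun t : ℝ => q.1 - t • q.2) := by fun_prop
  refine mem_closure_of_tendsto ((hc.tendsto (tauMinus X q.1 q.2)).mono_left
    (nhdsWithin_le_nhds (s := Iio (tauMinus X q.1 q.2)))) ?_
  filter_upwards [Ioo_mem_nhdsLT hpos] with t ht
  exact (sub_smul_mem_iff hXo hXb hXc (subset_closure hq) hv ht.1).2 ht.2

/-- Apart from the singular factor times φ at the entry point, every factor is measurable and
bounded: the attenuations are, because all endpoints stay in the bounded closure of X. -/
theorem integrable_scatterDensity (hXo : IsOpen X) (hXb : Bornology.IsBounded X)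
    (hXc : Convex ℝ X) (hσ : Measurable fun p : Space n × Space n => σ p.1 p.2)
    (hk : Measurable fun p : Space n × Space n × Space n => k p.1 p.2.1 p.2.2) {M N : ℝ}
    (hσM : ∀ x v, |σ x v| ≤ M) (hkN : ∀ x v w, |k x v w| ≤ N) {φ : Space n × Space n → ℝ}
    {x : Space n} (hx : x ∈ X)
    (hint : Integrable (fun q : Space n × Space n => (‖x - q.1‖ ^ (n - 1))⁻¹ * φ (entry X q))
      (((volume : Measure (Space n)).restrict X).prod (sphereMeasure n))) :
    Integrable (scatterDensity X σ k φ x)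
      (((volume : Measure (Space n)).restrict X).prod (sphereMeasure n)) := by
  set μ := ((volume : Measure (Space n)).restrict X).prod (sphereMeasure n) with hμ
  set B : Space n × Space n → ℝ := fun q => sigmaA σ k x (direction x q.1) *
    attenuation σ x q.1 * k q.1 q.2 (direction x q.1) * attenuation σ q.1 (entry X q).1 with hB
  have hM : 0 ≤ M := (abs_nonneg _).trans (hσM 0 0)
  have hN : 0 ≤ N := (abs_nonneg _).trans (hkN 0 0 0)
  obtain ⟨D, hD⟩ : ∃ D, ∀ y ∈ closure X, ∀ z ∈ closure X, ‖y - z‖ ≤ D :=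
    ⟨diam (closure X), fun y hy z hz => by
      rw [← dist_eq_norm]; exact dist_le_diam_of_mem hXb.closure hy hz⟩
  have hatt : ∀ y ∈ closure X, ∀ z ∈ closure X, attenuation σ y z ≤ Real.exp (M * D) :=
    fun y hy z hz => (attenuation_le hσM y z).trans
      (Real.exp_le_exp.2 (mul_le_mul_of_nonneg_left (hD y hy z hz) hM))
  have hd : Measurable fun q : Space n × Space n => direction x q.1 :=
    measurable_direction.comp (f := fun q : Space n × Space n => (x, q.1))
      (measurable_const.prodMk measurable_fst)
  have hBm : AEMeasurable B μ := by
    have h1 : Measurable fun q : Space n × Space n => sigmaA σ k x (direction x q.1) :=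
      (measurable_sigmaA hσ hk).comp (f := fun q : Space n × Space n => (x, direction x q.1))
        (measurable_const.prodMk hd)
    have h2 : Measurable fun q : Space n × Space n => attenuation σ x q.1 :=
      (measurable_attenuation hσ).comp (f := fun q : Space n × Space n => (x, q.1))
        (measurable_const.prodMk measurable_fst)
    have h3 : Measurable fun q : Space n × Space n => k q.1 q.2 (direction x q.1) :=
      hk.comp (g := fun p : Space n × Space n × Space n => k p.1 p.2.1 p.2.2)
        (f := fun q : Space n × Space n => (q.1, q.2, direction x q.1))
        (measurable_fst.prodMk (measurable_snd.prodMk hd))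
    have h4 : AEMeasurable (fun q => attenuation σ q.1 (entry X q).1) μ :=
      (measurable_attenuation hσ).comp_aemeasurable
        (f := fun q : Space n × Space n => (q.1, (entry X q).1))
        (measurable_fst.aemeasurable.prodMk (aemeasurable_entry hXo hXb hXc).fst)
    exact ((h1.mul h2).mul h3).aemeasurable.mul h4
  have hBb : ∀ᵐ q ∂μ, ‖B q‖ ≤ (M + N * (sphereMeasure n).real univ) * Real.exp (M * D) * N *
      Real.exp (M * D) := by
    filter_upwards [ae_phase hXo] with q hq
    have hτ := entry_fst_mem_closure hXo hXb hXc hq.1 hq.2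
    have h1 := abs_sigmaA_le hσM hkN x (direction x q.1)
    have h2 := hatt x (subset_closure hx) q.1 (subset_closure hq.1)
    have h3 := hatt q.1 (subset_closure hq.1) _ hτ
    have h0 : 0 ≤ M + N * (sphereMeasure n).real univ := by positivity
    have h4 := hkN q.1 q.2 (direction x q.1)
    simp only [hB, norm_mul, Real.norm_eq_abs, abs_of_pos (attenuation_pos (σ := σ) _ _)]
    exact mul_le_mul (mul_le_mul (mul_le_mul h1 h2 (attenuation_pos _ _).le h0) h4 (abs_nonneg _)
      (mul_nonneg h0 (Real.exp_pos _).le)) h3 (attenuation_pos _ _).le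
      (mul_nonneg (mul_nonneg h0 (Real.exp_pos _).le) hN)
  have h := hint.bdd_mul hBm.aestronglyMeasurable hBb
  refine h.congr ?_
  filter_upwards [ae_phase hXo] with q hq
  rw [scatterDensity, ballistic_eq hq.2]
  simp only [hB]
  ring

/-- Polar coordinates about x: the Jacobian t^(n-1) cancels the factor |x - y|^(1-n), and the
direction from y = x - tv to x is v. -/
theorem albedoOne_eq_integral (hn : 2 ≤ n) (hXo : IsOpen X) (hXb : Bornology.IsBounded X)
    (hXc : Convex ℝ X) {φ : Space n × Space n → ℝ} {x : Space n} (hx : x ∈ X)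
    (hint : Integrable (scatterDensity X σ k φ x)
      (((volume : Measure (Space n)).restrict X).prod (sphereMeasure n))) :
    albedoOne X σ k φ x = ∫ q, scatterDensity X σ k φ x q
      ∂(((volume : Measure (Space n)).restrict X).prod (sphereMeasure n)) := by
  rw [integral_prod _ hint, setIntegral_eq_polar hn hXo hXb hXc hint.integral_prod_left hx]
  refine integral_congr_ae (ae_norm_sphereMeasure.mono fun v hv => ?_)
  beta_reduce
  rw [scatter, ← intervalIntegral.integral_const_mul,
    intervalIntegral.integral_of_le (tauMinus_nonneg _ _),
    intervalIntegral.integral_of_le (tauMinus_nonneg _ _)]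
  refine setIntegral_congr_fun measurableSet_Ioc fun t ht => ?_
  simp only [scatterDensity, direction_sub_smul hv ht.1, norm_sub_sub_smul hv ht.1.le]
  rw [integral_const_mul]
  have : t ^ (n - 1) ≠ 0 := pow_ne_zero _ ht.1.ne'
  field_simp

theorem scatterDensity_rayPoint (hXo : IsOpen X) (hXb : Bornology.IsBounded X)
    (hXc : Convex ℝ X) {φ : Space n × Space n → ℝ} {x : Space n}
    {p : (Space n × Space n) × ℝ} (hp : p.1 ∈ incoming X) (hr : p ∈ rays X) :
    scatterDensity X σ k φ x (rayPoint p) = kernelDensity σ k x p.1.1 p.1.2 p.2 * φ p.1 := by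
  have hv : ‖p.1.2‖ = 1 := by simpa using hp.2.1
  have h := ballistic_eq (X := X) (σ := σ) (φ := φ) (y := (rayPoint p).1) (v := (rayPoint p).2) hv
  rw [Prod.mk.eta, entry_rayPoint hXo hXb hXc hp hr] at h
  rw [scatterDensity, h, kernelDensity, rayPoint]
  simp only [sub_add_eq_sub_sub]
  ring

/-- The phase-space integral is transported to ray coordinates and integrated along each ray first;
Fubini supplies the integrability over Γ₋ as well. -/
theorem integral_scatterDensity_eq (hXo : IsOpen X) (hXb : Bornology.IsBounded X)
    (hXc : Convex ℝ X) (hX : HasC1Boundary X) {φ : Space n × Space n → ℝ} {x : Space n}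
    (hint : Integrable (scatterDensity X σ k φ x)
      (((volume : Measure (Space n)).restrict X).prod (sphereMeasure n))) :
    Integrable (fun p : Space n × Space n => alphaOne X σ k x p.1 p.2 * φ p) (incomingMeasure X) ∧
      ∫ q, scatterDensity X σ k φ x q
        ∂(((volume : Measure (Space n)).restrict X).prod (sphereMeasure n)) =
      ∫ p, alphaOne X σ k x p.1 p.2 * φ p ∂(incomingMeasure X) := by
  have := sFinite_fluxMeasure hXo hXb hX
  have hray := measurableSet_rays hXo
  rw [← map_rayPoint hXo hXb hXc hX] at hint ⊢
  rw [integral_map measurable_rayPoint.aemeasurable hint.1]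
  rw [integrable_map_measure hint.1 measurable_rayPoint.aemeasurable] at hint
  set H : (Space n × Space n) × ℝ → ℝ :=
    (rays X).indicator fun p => scatterDensity X σ k φ x (rayPoint p) with hH
  have hHi : Integrable H ((fluxMeasure X).prod volume) :=
    (integrable_indicator_iff hray).2 hint
  rw [← integral_indicator hray]
  change _ ∧ ∫ p, H p ∂_ = _
  rw [integral_prod _ hHi]
  set J : Space n × Space n → ℝ := fun p =>
    ∫ t in (0 : ℝ)..tauPlus X p.1 p.2, kernelDensity σ k x p.1 p.2 t with hJ
  have hinner : (fun p => ∫ t, H (p, t)) =ᵐ[fluxMeasure X] fun p => J p * φ p := by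
    filter_upwards [ae_fluxMeasure_mem_incoming hXo hXc hX] with p hp
    have hv : ‖p.2‖ = 1 := by simpa using hp.2.1
    have hcl := frontier_subset_closure hp.1
    rw [hJ, ← intervalIntegral.integral_mul_const,
      intervalIntegral.integral_of_le (tauPlus_nonneg _ _), integral_Ioc_eq_integral_Ioo,
      ← integral_indicator measurableSet_Ioo]
    refine integral_congr_ae (Eventually.of_forall fun t => ?_)
    beta_reduce
    have hiff : (p, t) ∈ rays X ↔ t ∈ Ioo 0 (tauPlus X p.1 p.2) := by
      rw [← setOf_pos_mem_eq_Ioo hXo hXb hXc hcl hv]; rfl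
    by_cases ht : (p, t) ∈ rays X
    · rw [hH, indicator_of_mem ht, indicator_of_mem (hiff.1 ht),
        scatterDensity_rayPoint hXo hXb hXc hp ht]
    · rw [hH, indicator_of_notMem ht, indicator_of_notMem (hiff.not.1 ht)]
  have hJi : Integrable (fun p => J p * φ p) (fluxMeasure X) :=
    hHi.integral_prod_left.congr hinner
  rw [integral_congr_ae hinner]
  have hd := aemeasurable_flux_density hXo hXc hX
  have hfin : ∀ᵐ p ∂(incomingMeasure X), ENNReal.ofReal |⟪outwardNormal X p.1, p.2⟫| < ⊤ :=
    Eventually.of_forall fun _ => ENNReal.ofReal_lt_top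
  -- The density of dξ with respect to dμ dv' is the prefactor of α₁.
  have halpha : ∀ p : Space n × Space n,
      (ENNReal.ofReal |⟪outwardNormal X p.1, p.2⟫|).toReal • (J p * φ p) =
        alphaOne X σ k x p.1 p.2 * φ p := by
    intro p
    rw [ENNReal.toReal_ofReal (abs_nonneg _), smul_eq_mul, ← mul_assoc]
    rfl
  rw [fluxMeasure] at hJi ⊢
  constructor
  · have := (integrable_withDensity_iff_integrable_smul₀' hd hfin).1 hJi
    simpa only [halpha] using this
  · rw [integral_withDensity_eq_integral_toReal_smul₀ hd hfin]
    simp only [halpha]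

theorem isSchwartzKernel_of_measurable (hn : 2 ≤ n) (hXo : IsOpen X)
    (hXb : Bornology.IsBounded X) (hXc : Convex ℝ X) (hX : HasC1Boundary X)
    (hσ : Measurable fun p : Space n × Space n => σ p.1 p.2)
    (hk : Measurable fun p : Space n × Space n × Space n => k p.1 p.2.1 p.2.2) {M N : ℝ}
    (hσM : ∀ x v, |σ x v| ≤ M) (hkN : ∀ x v w, |k x v w| ≤ N) :
    IsSchwartzKernel X (albedoOne X σ k) (alphaOne X σ k) := by
  intro φ hφ
  filter_upwards [ae_integrable_singular hn hXo hXb (integrable_comp_entry hXo hXb hXc hX hφ),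
    ae_restrict_mem hXo.measurableSet] with x hint hx
  have h := integrable_scatterDensity hXo hXb hXc hσ hk hσM hkN hx hint
  rw [albedoOne_eq_integral hn hXo hXb hXc hx h]
  exact integral_scatterDensity_eq hXo hXb hXc hX h

/-- Bounded continuous coefficients agree inside the domain with bounded measurable ones. -/
theorem exists_measurable_extension {Y : Type*} [TopologicalSpace Y] [MeasurableSpace Y]
    [BorelSpace Y] {f : Y → ℝ} {S : Set Y} (hS : MeasurableSet S)
    (hf : BoundedContinuousOn f S) :
    ∃ g : Y → ℝ, Measurable g ∧ (∃ M, ∀ y, |g y| ≤ M) ∧ EqOn f g S := by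
  obtain ⟨hc, M, hM⟩ := hf
  refine ⟨S.indicator f, ?_, ⟨|M|, fun y => ?_⟩, fun y hy => (indicator_of_mem hy f).symm⟩
  · classical
    have := hc.measurable_piecewise (g := (0 : Y → ℝ)) continuousOn_const hS
    rwa [piecewise_eq_indicator] at this
  · by_cases hy : y ∈ S
    · rw [indicator_of_mem hy]; exact (hM y hy).trans (le_abs_self M)
    · rw [indicator_of_notMem hy, abs_zero]; exact abs_nonneg M

theorem isSchwartzKernel_congr (hn : 2 ≤ n) (hXo : IsOpen X)
    (hXb : Bornology.IsBounded X) (hXc : Convex ℝ X) (hX : HasC1Boundary X)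
    {σ' : Space n → Space n → ℝ} {k' : Space n → Space n → Space n → ℝ}
    (hσ : ∀ x ∈ X, ∀ v, ‖v‖ = 1 → σ x v = σ' x v)
    (hk : ∀ x ∈ X, ∀ v w, ‖v‖ = 1 → ‖w‖ = 1 → k x v w = k' x v w)
    (h : IsSchwartzKernel X (albedoOne X σ' k') (alphaOne X σ' k')) :
    IsSchwartzKernel X (albedoOne X σ k) (alphaOne X σ k) := by
  intro φ hφ
  filter_upwards [h φ hφ, ae_restrict_mem hXo.measurableSet] with x hx hxX
  have hcongr : (fun p : Space n × Space n => alphaOne X σ k x p.1 p.2 * φ p)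
      =ᵐ[incomingMeasure X] fun p => alphaOne X σ' k' x p.1 p.2 * φ p := by
    filter_upwards [ae_restrict_mem (measurableSet_incoming hXo hXc hX)] with p hp
    rw [alphaOne_congr hn hXo hXb hXc hσ hk hxX hp]
  rw [integrable_congr hcongr, integral_congr_ae hcongr, albedoOne_congr hXo hXb hXc hσ hk hxX]
  exact hx

end Kernel

end Photoacoustic

namespace Photoacoustic

/-! ### Concentration of one-dimensional kernels -/

section Asymptotics

theorem image_mul_cot {ε : ℝ} (hε : 0 < ε) :
    (fun θ : ℝ => ε * (Real.cos θ / Real.sin θ)) '' Ioo 0 Real.pi = univ := by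
  refine eq_univ_of_forall fun s => ⟨Real.pi / 2 - Real.arctan (s / ε), ⟨?_, ?_⟩, ?_⟩
  · linarith [Real.arctan_lt_pi_div_two (s / ε)]
  · linarith [Real.neg_pi_div_two_lt_arctan (s / ε)]
  · simp only [Real.cos_pi_div_two_sub, Real.sin_pi_div_two_sub, ← Real.tan_eq_sin_div_cos,
      Real.tan_arctan]
    field_simp

theorem injOn_mul_cot {ε : ℝ} (hε : 0 < ε) :
    InjOn (fun θ : ℝ => ε * (Real.cos θ / Real.sin θ)) (Ioo 0 Real.pi) := by
  intro a ha b hb hab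
  have hsa := Real.sin_pos_of_mem_Ioo ha
  have hsb := Real.sin_pos_of_mem_Ioo hb
  have h1 : Real.cos a / Real.sin a = Real.cos b / Real.sin b := mul_left_cancel₀ hε.ne' hab
  rw [div_eq_div_iff hsa.ne' hsb.ne'] at h1
  have h2 : Real.sin (b - a) = 0 := by rw [Real.sin_sub]; linarith
  have h3 := (Real.sin_eq_zero_iff_of_lt_of_lt (by linarith [ha.2, hb.1]) (by linarith [ha.1, hb.2])).1 h2
  linarith

/-- In the substitution s = ε cot θ, θ is the angle between v' and sv' + εw, and √(s² + ε²) becomes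
ε / sin θ. -/
theorem integral_eq_integral_cot {ε : ℝ} (hε : 0 < ε) (h : ℝ → ℝ) :
    ∫ s, h s = ∫ θ in Ioo 0 Real.pi,
      ε / Real.sin θ ^ 2 * h (ε * (Real.cos θ / Real.sin θ)) := by
  have hderiv : ∀ θ ∈ Ioo 0 Real.pi, HasDerivWithinAt
      (fun θ : ℝ => ε * (Real.cos θ / Real.sin θ)) (-(ε / Real.sin θ ^ 2)) (Ioo 0 Real.pi) θ := by
    intro θ hθ
    have hs := (Real.sin_pos_of_mem_Ioo hθ).ne'
    have := (((Real.hasDerivAt_cos θ).div (Real.hasDerivAt_sin θ) hs).const_mul ε).hasDerivWithinAt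
      (s := Ioo 0 Real.pi)
    have heq : ε * ((-Real.sin θ * Real.sin θ - Real.cos θ * Real.cos θ) / Real.sin θ ^ 2) =
        -(ε / Real.sin θ ^ 2) := by
      have hsq := Real.sin_sq_add_cos_sq θ
      rw [show -Real.sin θ * Real.sin θ - Real.cos θ * Real.cos θ = -1 by linarith]
      ring
    rw [heq] at this
    exact this
  have := integral_image_eq_integral_abs_deriv_smul measurableSet_Ioo hderiv (injOn_mul_cot hε) h
  rw [image_mul_cot hε, Measure.restrict_univ] at this
  rw [this]
  refine setIntegral_congr_fun measurableSet_Ioo fun θ hθ => ?_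
  rw [abs_neg, abs_of_nonneg (by positivity), smul_eq_mul]

theorem sqrt_mul_cot {ε θ : ℝ} (hε : 0 < ε) (hθ : θ ∈ Ioo 0 Real.pi) :
    √((ε * (Real.cos θ / Real.sin θ)) ^ 2 + ε ^ 2) = ε / Real.sin θ := by
  have hs := Real.sin_pos_of_mem_Ioo hθ
  have hsq := Real.sin_sq_add_cos_sq θ
  rw [Real.sqrt_eq_iff_eq_sq (by positivity) (by positivity)]
  field_simp
  linarith

/-- Concentration of the kernel `(s² + ε²)^{-m/2}`, `m ≥ 2`, at `s = 0`. -/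
theorem tendsto_integral_div_sqrt_pow {m : ℕ} (hm : 2 ≤ m) {a : ℝ → ℝ → ℝ} {g : ℝ → ℝ} {C : ℝ}
    (hmeas : ∀ᶠ ε in 𝓝[>] (0 : ℝ), Measurable (a ε))
    (hbound : ∀ᶠ ε in 𝓝[>] (0 : ℝ), ∀ s, |a ε s| ≤ C)
    (hlim : ∀ θ ∈ Ioo 0 Real.pi,
      Tendsto (fun ε => a ε (ε * (Real.cos θ / Real.sin θ))) (𝓝[>] 0) (𝓝 (g θ))) :
    Tendsto (fun ε => ε ^ (m - 1) * ∫ s, a ε s / √(s ^ 2 + ε ^ 2) ^ m) (𝓝[>] 0)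
      (𝓝 (∫ θ in (0 : ℝ)..Real.pi, Real.sin θ ^ (m - 2) * g θ)) := by
  have heq : ∀ᶠ ε in 𝓝[>] (0 : ℝ), ∫ θ in Ioo 0 Real.pi,
      Real.sin θ ^ (m - 2) * a ε (ε * (Real.cos θ / Real.sin θ)) =
      ε ^ (m - 1) * ∫ s, a ε s / √(s ^ 2 + ε ^ 2) ^ m := by
    filter_upwards [self_mem_nhdsWithin] with ε hε
    have hε : 0 < ε := hε
    rw [integral_eq_integral_cot hε, ← integral_const_mul]
    refine setIntegral_congr_fun measurableSet_Ioo fun θ hθ => ?_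
    have hs := Real.sin_pos_of_mem_Ioo hθ
    rw [sqrt_mul_cot hε hθ]
    obtain ⟨j, rfl⟩ := Nat.exists_eq_add_of_le hm
    rw [show 2 + j - 2 = j by omega, show 2 + j - 1 = j + 1 by omega, div_pow]
    field_simp
    ring
  refine Tendsto.congr' heq ?_
  rw [intervalIntegral.integral_of_le Real.pi_pos.le, integral_Ioc_eq_integral_Ioo]
  -- What is left of the kernel is sin^(m-2) θ ≤ 1 on a bounded interval, so a constant dominates.
  -- For m = 1 the weight would be 1 / sin θ, the source of the logarithm.
  refine tendsto_integral_filter_of_dominated_convergence (fun _ => C) ?_ ?_ ?_ ?_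
  · filter_upwards [hmeas] with ε hε
    exact ((Real.measurable_sin.pow_const _).mul (hε.comp
      ((Real.measurable_cos.div Real.measurable_sin).const_mul ε))).aestronglyMeasurable
  · filter_upwards [hbound] with ε hε
    refine Eventually.of_forall fun θ => ?_
    rw [norm_mul, norm_pow, Real.norm_eq_abs, Real.norm_eq_abs]
    calc |Real.sin θ| ^ (m - 2) * |a ε (ε * (Real.cos θ / Real.sin θ))|
        ≤ 1 * |a ε (ε * (Real.cos θ / Real.sin θ))| := by
          gcongr; exact pow_le_one₀ (abs_nonneg _) (Real.abs_sin_le_one θ)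
      _ ≤ C := by rw [one_mul]; exact hε _
  · exact integrable_const _
  · filter_upwards [ae_restrict_mem measurableSet_Ioo] with θ hθ
    exact (hlim θ hθ).const_mul _

/-- Used with l = log ε, so that s = ε^r and ds / s is log(1/ε) dr up to orientation. -/
theorem integral_Ioi_eq_integral_exp {l : ℝ} (hl : l < 0) (h : ℝ → ℝ) :
    ∫ s in Ioi 0, h s = ∫ r, -l * Real.exp (r * l) * h (Real.exp (r * l)) := by
  have himage : (fun r : ℝ => Real.exp (r * l)) '' univ = Ioi 0 := by
    ext s
    constructor
    · rintro ⟨r, -, rfl⟩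
      exact Real.exp_pos _
    · intro hs
      refine ⟨Real.log s / l, mem_univ _, ?_⟩
      simp only [div_mul_cancel₀ _ hl.ne]
      exact Real.exp_log hs
  have hinj : InjOn (fun r : ℝ => Real.exp (r * l)) univ := fun a _ b _ hab =>
    mul_right_cancel₀ hl.ne (Real.exp_injective hab)
  have hderiv : ∀ r ∈ (univ : Set ℝ), HasDerivWithinAt (fun r : ℝ => Real.exp (r * l))
      (Real.exp (r * l) * (1 * l)) univ r := fun r _ =>
    (((hasDerivAt_id r).mul_const l).exp).hasDerivWithinAt
  have := integral_image_eq_integral_abs_deriv_smul MeasurableSet.univ hderiv hinj h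
  rw [himage, Measure.restrict_univ] at this
  rw [this]
  refine integral_congr_ae (Eventually.of_forall fun r => ?_)
  simp only [one_mul, smul_eq_mul, abs_mul, abs_of_neg hl, abs_of_pos (Real.exp_pos _)]
  ring

theorem tendsto_exp_mul_log {c : ℝ} (hc : 0 < c) :
    Tendsto (fun ε => Real.exp (c * Real.log ε)) (𝓝[>] 0) (𝓝 0) :=
  Real.tendsto_exp_atBot.comp (Real.tendsto_log_nhdsGT_zero.const_mul_atBot hc)

/-- Logarithmic concentration of the kernel `(s² + ε²)^{-1/2}` at `s = 0⁺`. -/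
theorem tendsto_integral_Ioi_div_sqrt {a : ℝ → ℝ → ℝ} {g C R : ℝ} (hR : 0 < R)
    (hmeas : ∀ᶠ ε in 𝓝[>] (0 : ℝ), Measurable (a ε))
    (hbound : ∀ᶠ ε in 𝓝[>] (0 : ℝ), ∀ s, |a ε s| ≤ C)
    (hsupp : ∀ ε s, R < s → a ε s = 0)
    (hlim : ∀ r ∈ Ioo (0 : ℝ) 1,
      Tendsto (fun ε => a ε (Real.exp (r * Real.log ε))) (𝓝[>] 0) (𝓝 g)) :
    Tendsto (fun ε => (Real.log (1 / ε))⁻¹ * ∫ s in Ioi 0, a ε s / √(s ^ 2 + ε ^ 2))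
      (𝓝[>] 0) (𝓝 g) := by
  set w : ℝ → ℝ → ℝ := fun ε r =>
    Real.exp (r * Real.log ε) / √(Real.exp (r * Real.log ε) ^ 2 + ε ^ 2) with hw
  have hlogneg : ∀ᶠ ε in 𝓝[>] (0 : ℝ), Real.log ε < -1 ∧ Real.log ε < -|Real.log R| :=
    (Real.tendsto_log_nhdsGT_zero.eventually_lt_atBot _).and
      (Real.tendsto_log_nhdsGT_zero.eventually_lt_atBot _)
  have heq : ∀ᶠ ε in 𝓝[>] (0 : ℝ), ∫ r, a ε (Real.exp (r * Real.log ε)) * w ε r =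
      (Real.log (1 / ε))⁻¹ * ∫ s in Ioi 0, a ε s / √(s ^ 2 + ε ^ 2) := by
    filter_upwards [hlogneg] with ε hl
    have hl0 : Real.log ε < 0 := by linarith [hl.1]
    rw [integral_Ioi_eq_integral_exp hl0, ← integral_const_mul]
    refine integral_congr_ae (Eventually.of_forall fun r => ?_)
    simp only [hw, one_div, Real.log_inv]
    have := hl0.ne
    field_simp
  refine Tendsto.congr' heq ?_
  have hw0 : ∀ ε r, 0 ≤ w ε r := fun ε r => by positivity
  have hw1 : ∀ ε r, w ε r ≤ 1 := fun ε r => by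
    refine div_le_one_of_le₀ (Real.le_sqrt_of_sq_le ?_) (Real.sqrt_nonneg _)
    nlinarith [sq_nonneg ε]
  have hw2 : ∀ ε r, 0 < ε → w ε r ≤ Real.exp ((r - 1) * Real.log ε) := fun ε r hε => by
    have h1 : ε ≤ √(Real.exp (r * Real.log ε) ^ 2 + ε ^ 2) :=
      Real.le_sqrt_of_sq_le (by nlinarith [sq_nonneg (Real.exp (r * Real.log ε))])
    calc w ε r ≤ Real.exp (r * Real.log ε) / ε :=
          div_le_div_of_nonneg_left (Real.exp_pos _).le hε h1
      _ = _ := by rw [sub_mul, one_mul, Real.exp_sub, Real.exp_log hε]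
  -- With s = ε^r, the weight w tends to 1 for r < 1 and to 0 for r > 1, while r < 0 leaves the
  -- support. Only the scales between ε and 1 survive.
  set G : ℝ → ℝ := (Ioo (0 : ℝ) 1).indicator fun _ => g with hG
  have hGint : ∫ r, G r = g := by
    rw [hG, integral_indicator measurableSet_Ioo, setIntegral_const]
    simp
  rw [← hGint]
  -- For r < -1 the integrand vanishes, since log ε < -|log R| gives ε^r > R. For -1 ≤ r ≤ 1, w ≤ 1
  -- ≤ e^(1-r); for r ≥ 1, w ≤ ε^(r-1) ≤ e^(1-r) because log ε < -1.
  refine tendsto_integral_filter_of_dominated_convergence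
    ((Ici (-1 : ℝ)).indicator fun r => |C| * Real.exp (1 - r)) ?_ ?_ ?_ ?_
  · filter_upwards [hmeas] with ε hε
    have h1 : Measurable fun r : ℝ => Real.exp (r * Real.log ε) := by fun_prop
    refine Measurable.aestronglyMeasurable ((hε.comp h1).mul ?_)
    simp only [hw]
    fun_prop
  · filter_upwards [hbound, hlogneg, self_mem_nhdsWithin] with ε hb hl hε
    refine Eventually.of_forall fun r => ?_
    have hε : 0 < ε := hε
    by_cases hr : -1 ≤ r
    · rw [indicator_of_mem (mem_Ici.2 hr), norm_mul, Real.norm_eq_abs, Real.norm_of_nonneg (hw0 _ _)]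
      refine mul_le_mul ((hb _).trans (le_abs_self C)) ?_ (hw0 _ _) (abs_nonneg _)
      rcases le_total r 1 with h1 | h1
      · exact (hw1 _ _).trans (Real.one_le_exp (by linarith))
      · refine (hw2 ε r hε).trans (Real.exp_le_exp.2 ?_)
        nlinarith [hl.1]
    · have hlt : R < Real.exp (r * Real.log ε) := by
        rw [← Real.log_lt_iff_lt_exp hR]
        have := le_abs_self (Real.log R)
        have := abs_nonneg (Real.log R)
        nlinarith [hl.2]
      rw [hsupp _ _ hlt, zero_mul, norm_zero]
      exact indicator_nonneg (fun r _ => by positivity) r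
  · rw [integrable_indicator_iff measurableSet_Ici, integrableOn_Ici_iff_integrableOn_Ioi]
    refine Integrable.const_mul ?_ _
    have := (integrableOn_exp_neg_Ioi (-1)).const_mul (Real.exp 1)
    refine this.congr (Eventually.of_forall fun r => ?_)
    simp only [← Real.exp_add, sub_eq_add_neg]
  · have h01 : ∀ᵐ r : ℝ, r ≠ 0 ∧ r ≠ 1 :=
      (Measure.ae_ne volume 0).and (Measure.ae_ne volume 1)
    filter_upwards [h01] with r hr
    rcases lt_trichotomy r 0 with h0 | h0 | h0
    · rw [hG, indicator_of_notMem fun h => absurd h.1 (not_lt.2 h0.le)]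
      have hatTop : Tendsto (fun ε => Real.exp (r * Real.log ε)) (𝓝[>] 0) atTop :=
        Real.tendsto_exp_atTop.comp (Real.tendsto_log_nhdsGT_zero.const_mul_atBot_of_neg h0)
      refine tendsto_const_nhds.congr' ?_
      filter_upwards [hatTop.eventually_gt_atTop R] with ε hε
      rw [hsupp _ _ hε, zero_mul]
    · exact absurd h0 hr.1
    · rcases lt_or_gt_of_ne hr.2 with h1 | h1
      · rw [hG, indicator_of_mem (show r ∈ Ioo (0 : ℝ) 1 from ⟨h0, h1⟩)]
        have hwlim : Tendsto (fun ε => w ε r) (𝓝[>] 0) (𝓝 1) := by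
          have h2 : Tendsto (fun ε => 1 / √(1 + Real.exp ((1 - r) * Real.log ε) ^ 2)) (𝓝[>] 0)
              (𝓝 (1 / √(1 + (0 : ℝ) ^ 2))) := by
            refine Tendsto.div tendsto_const_nhds ?_ (by simp)
            exact (((tendsto_exp_mul_log (sub_pos.2 h1)).pow 2).const_add 1).sqrt
          simp only [ne_eq, OfNat.ofNat_ne_zero, not_false_eq_true, zero_pow, add_zero,
            Real.sqrt_one, div_one] at h2
          refine h2.congr' ?_
          filter_upwards [self_mem_nhdsWithin] with ε hε
          have hε : 0 < ε := hε
          have hs := Real.exp_pos (r * Real.log ε)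
          have h3 : Real.exp ((1 - r) * Real.log ε) = ε / Real.exp (r * Real.log ε) := by
            rw [sub_mul, one_mul, Real.exp_sub, Real.exp_log hε]
          have h4 : Real.exp (r * Real.log ε) ^ 2 + ε ^ 2 = Real.exp (r * Real.log ε) ^ 2 *
              (1 + (ε / Real.exp (r * Real.log ε)) ^ 2) := by
            field_simp
          simp only [hw]
          rw [h3, h4, Real.sqrt_mul (by positivity), Real.sqrt_sq hs.le, ← div_div,
            div_self hs.ne']
        simpa using (hlim r ⟨h0, h1⟩).mul hwlim
      · rw [hG, indicator_of_notMem fun h => absurd h.2 (not_lt.2 h1.le)]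
        have hz : Tendsto (fun ε => |C| * Real.exp ((r - 1) * Real.log ε)) (𝓝[>] 0) (𝓝 0) := by
          simpa using (tendsto_exp_mul_log (sub_pos.2 h1)).const_mul |C|
        refine squeeze_zero_norm' ?_ hz
        filter_upwards [hbound, self_mem_nhdsWithin] with ε hb hε
        rw [norm_mul, Real.norm_eq_abs, Real.norm_of_nonneg (hw0 _ _)]
        exact mul_le_mul ((hb _).trans (le_abs_self C)) (hw2 ε r hε) (hw0 _ _) (abs_nonneg _)

theorem tendsto_integral_div_sqrt {a : ℝ → ℝ → ℝ} {g g' C R : ℝ} (hR : 0 < R)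
    (hmeas : ∀ᶠ ε in 𝓝[>] (0 : ℝ), Measurable (a ε))
    (hbound : ∀ᶠ ε in 𝓝[>] (0 : ℝ), ∀ s, |a ε s| ≤ C)
    (hsupp : ∀ ε s, R < |s| → a ε s = 0)
    (hlim : ∀ r ∈ Ioo (0 : ℝ) 1,
      Tendsto (fun ε => a ε (Real.exp (r * Real.log ε))) (𝓝[>] 0) (𝓝 g))
    (hlim' : ∀ r ∈ Ioo (0 : ℝ) 1,
      Tendsto (fun ε => a ε (-Real.exp (r * Real.log ε))) (𝓝[>] 0) (𝓝 g')) :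
    Tendsto (fun ε => (Real.log (1 / ε))⁻¹ * ∫ s, a ε s / √(s ^ 2 + ε ^ 2))
      (𝓝[>] 0) (𝓝 (g + g')) := by
  have h1 := tendsto_integral_Ioi_div_sqrt hR hmeas hbound
    (fun ε s hs => hsupp ε s (hs.trans_le (le_abs_self s))) hlim
  have h2 := tendsto_integral_Ioi_div_sqrt (a := fun ε s => a ε (-s)) hR
    (hmeas.mono fun ε hε => hε.comp measurable_neg) (hbound.mono fun ε hε s => hε (-s))
    (fun ε s hs => hsupp ε (-s) (by rw [abs_neg]; exact hs.trans_le (le_abs_self s))) hlim'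
  refine (h1.add h2).congr' ?_
  filter_upwards [hmeas, hbound, self_mem_nhdsWithin] with ε hm hb hε
  have hε : 0 < ε := hε
  have hint : Integrable fun s => a ε s / √(s ^ 2 + ε ^ 2) := by
    have hsub : ∀ s, s ∉ Icc (-R) R → a ε s / √(s ^ 2 + ε ^ 2) = 0 := fun s hs => by
      rw [hsupp ε s (not_le.1 fun h => hs (abs_le.1 h)), zero_div]
    rw [← integrableOn_iff_integrable_of_support_subset (s := Icc (-R) R)
      (fun s hs => by_contra fun h => hs (hsub s h))]
    refine Integrable.mono' (g := fun _ => |C| / ε) (integrable_const _)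
      (hm.div (by fun_prop)).aestronglyMeasurable (Eventually.of_forall fun s => ?_)
    rw [norm_div, Real.norm_eq_abs, Real.norm_of_nonneg (Real.sqrt_nonneg _)]
    exact div_le_div₀ (abs_nonneg _) ((hb s).trans (le_abs_self C)) hε
      (Real.le_sqrt_of_sq_le (by nlinarith [sq_nonneg s]))
  rw [← mul_add, ← integral_add_compl (measurableSet_Ioi (a := (0 : ℝ))) hint, compl_Ioi]
  congr 2
  have := integral_comp_neg_Ioi (c := (0 : ℝ)) (fun s => a ε s / √(s ^ 2 + ε ^ 2))
  rw [neg_zero] at this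
  rw [← this]
  simp only [neg_sq]

end Asymptotics

end Photoacoustic

namespace Photoacoustic

/-! ### The integrand of α₁ near the incoming ray -/

section NearRay

variable {n : ℕ} {X : Set (Space n)} {σ : Space n → Space n → ℝ}
  {k : Space n → Space n → Space n → ℝ}

theorem continuousOn_sigmaA
    (hk : Measurable fun p : Space n × Space n × Space n => k p.1 p.2.1 p.2.2) {N : ℝ}
    (hkN : ∀ x v w, |k x v w| ≤ N)
    (hσc : ContinuousOn (fun p : Space n × Space n => σ p.1 p.2) (X ×ˢ sphere (0 : Space n) 1))
    (hkc : ContinuousOn (fun p : Space n × Space n × Space n => k p.1 p.2.1 p.2.2)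
      (X ×ˢ sphere (0 : Space n) 1 ×ˢ sphere (0 : Space n) 1)) :
    ContinuousOn (fun p : Space n × Space n => sigmaA σ k p.1 p.2)
      (X ×ˢ sphere (0 : Space n) 1) := by
  refine hσc.sub ?_
  refine continuousOn_of_dominated (F := fun p : Space n × Space n => k p.1 p.2)
    (bound := fun _ => N) (fun p _ => ?_) (fun p _ => Eventually.of_forall fun w =>
      (Real.norm_eq_abs _).trans_le (hkN _ _ _)) (integrable_const _) ?_
  · exact (hk.comp (f := fun w : Space n => (p.1, p.2, w)) (by fun_prop)).aestronglyMeasurable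
  · filter_upwards [ae_norm_sphereMeasure] with w hw
    refine hkc.comp (f := fun p : Space n × Space n => (p.1, p.2, w))
      (by fun_prop) fun p hp => ⟨hp.1, hp.2, ?_⟩
    simpa using hw

/-- The exponent is at most M times the distance between the endpoints, so no continuity of σ is
involved. -/
theorem tendsto_attenuation_one {ι : Type*} {l : Filter ι} {M : ℝ} (hσM : ∀ x v, |σ x v| ≤ M)
    {f g : ι → Space n} (h : Tendsto (fun i => ‖f i - g i‖) l (𝓝 0)) :
    Tendsto (fun i => attenuation σ (f i) (g i)) l (𝓝 1) := by
  rw [← Real.exp_zero]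
  refine (Real.continuous_exp.tendsto 0).comp ?_
  refine squeeze_zero_norm (a := fun i => M * ‖f i - g i‖) (fun i => ?_) (by simpa using h.const_mul M)
  rw [norm_neg]
  refine (intervalIntegral.norm_integral_le_of_norm_le_const (C := M) fun s _ =>
    (Real.norm_eq_abs _).trans_le (hσM _ _)).trans ?_
  rw [sub_zero, abs_of_nonneg (norm_nonneg _)]

theorem attenuation_add_smul {x v : Space n} (hv : ‖v‖ = 1) {t : ℝ} (ht : 0 ≤ t) :
    attenuation σ (x + t • v) x = Real.exp (-∫ q in (0 : ℝ)..t, σ (x + q • v) v) := by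
  have h := attenuation_sub_smul (σ := σ) (x := x + t • v) hv ht
  rw [add_sub_cancel_right] at h
  rw [h]
  have h2 := intervalIntegral.integral_comp_sub_left (a := 0) (b := t)
    (fun q : ℝ => σ (x + q • v) v) t
  rw [sub_self, sub_zero] at h2
  rw [← h2]
  simp only [sub_smul, add_sub_assoc]

theorem tendsto_attenuation_along_ray
    (hσ : Measurable fun p : Space n × Space n => σ p.1 p.2) {M : ℝ}
    (hσM : ∀ x v, |σ x v| ≤ M) {x v : Space n} (hv : ‖v‖ = 1) {t : ℝ} (ht : 0 < t)
    {ι : Type*} {l : Filter ι} {f : ι → ℝ} (hf : Tendsto f l (𝓝 t)) :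
    Tendsto (fun i => attenuation σ (x + f i • v) x) l (𝓝 (attenuation σ (x + t • v) x)) := by
  have hm : Measurable fun q : ℝ => σ (x + q • v) v :=
    hσ.comp (f := fun q : ℝ => (x + q • v, v)) (by fun_prop)
  have hint : ∀ a b, IntervalIntegrable (fun q : ℝ => σ (x + q • v) v) volume a b := fun a b =>
    (intervalIntegrable_const (c := M)).mono_fun hm.aestronglyMeasurable
      (Eventually.of_forall fun q => by
        beta_reduce
        rw [Real.norm_eq_abs, Real.norm_eq_abs]; exact (hσM _ _).trans (le_abs_self M))
  have hc := intervalIntegral.continuous_primitive hint 0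
  rw [attenuation_add_smul hv ht.le]
  have h1 := (Real.continuous_exp.comp hc.neg).tendsto t |>.comp hf
  refine h1.congr' ?_
  filter_upwards [hf.eventually (lt_mem_nhds ht)] with i hi
  exact (attenuation_add_smul hv hi.le).symm

theorem direction_offset (x v w : Space n) (ε s : ℝ) :
    direction (x + ε • w) (x - s • v) = ‖s • v + ε • w‖⁻¹ • (s • v + ε • w) := by
  rw [direction, show x + ε • w - (x - s • v) = s • v + ε • w by abel]

theorem norm_offset {v w : Space n} (hv : ‖v‖ = 1) (hw : ‖w‖ = 1) (hvw : ⟪v, w⟫ = 0) (ε s : ℝ) :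
    ‖s • v + ε • w‖ = √(s ^ 2 + ε ^ 2) := by
  rw [eq_comm, Real.sqrt_eq_iff_eq_sq (by positivity) (norm_nonneg _), norm_add_sq_real,
    real_inner_smul_left, real_inner_smul_right, hvw, norm_smul, norm_smul, hv, hw]
  simp

theorem normalize_smul {c : ℝ} (hc : 0 < c) (z : Space n) :
    ‖c • z‖⁻¹ • (c • z) = ‖z‖⁻¹ • z := by
  rw [norm_smul, Real.norm_of_nonneg hc.le, smul_smul, mul_inv, mul_right_comm,
    inv_mul_cancel₀ hc.ne', one_mul]

/-- The integrand of `α₁` at the point `x' + t₀ v' + ε w`, in the variable `s = t₀ - t`, without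
its singular factor and divided by `E(x' + t₀ v', x')`. -/
noncomputable def nearRayDensity (X : Set (Space n)) (σ : Space n → Space n → ℝ)
    (k : Space n → Space n → Space n → ℝ) (x' v' w : Space n) (t₀ ε : ℝ) : ℝ → ℝ :=
  (Ioo (t₀ - tauPlus X x' v') t₀).indicator fun s =>
    sigmaA σ k (x' + t₀ • v' + ε • w) (direction (x' + t₀ • v' + ε • w) (x' + t₀ • v' - s • v')) *
      (attenuation σ (x' + t₀ • v' + ε • w) (x' + t₀ • v' - s • v') *
        attenuation σ (x' + t₀ • v' - s • v') x') *
      k (x' + t₀ • v' - s • v') v'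
        (direction (x' + t₀ • v' + ε • w) (x' + t₀ • v' - s • v')) /
      attenuation σ (x' + t₀ • v') x'

theorem measurable_nearRayDensity (hσ : Measurable fun p : Space n × Space n => σ p.1 p.2)
    (hk : Measurable fun p : Space n × Space n × Space n => k p.1 p.2.1 p.2.2)
    (x' v' w : Space n) (t₀ ε : ℝ) : Measurable (nearRayDensity X σ k x' v' w t₀ ε) := by
  refine Measurable.indicator ?_ measurableSet_Ioo
  have hy : Measurable fun s : ℝ => x' + t₀ • v' - s • v' := by fun_prop
  have hd : Measurable fun s : ℝ =>
      direction (x' + t₀ • v' + ε • w) (x' + t₀ • v' - s • v') :=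
    measurable_direction.comp (f := fun s : ℝ =>
      (x' + t₀ • v' + ε • w, x' + t₀ • v' - s • v')) (measurable_const.prodMk hy)
  have h1 := (measurable_sigmaA hσ hk).comp (f := fun s : ℝ => (x' + t₀ • v' + ε • w,
    direction (x' + t₀ • v' + ε • w) (x' + t₀ • v' - s • v'))) (measurable_const.prodMk hd)
  have h2 := (measurable_attenuation hσ).comp (f := fun s : ℝ =>
    (x' + t₀ • v' + ε • w, x' + t₀ • v' - s • v')) (measurable_const.prodMk hy)
  have h3 := (measurable_attenuation hσ).comp (f := fun s : ℝ =>
    (x' + t₀ • v' - s • v', x')) (hy.prodMk measurable_const)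
  have h4 := hk.comp (f := fun s : ℝ => (x' + t₀ • v' - s • v', v',
    direction (x' + t₀ • v' + ε • w) (x' + t₀ • v' - s • v')))
    (hy.prodMk (measurable_const.prodMk hd))
  exact ((h1.mul (h2.mul h3)).mul h4).div_const _

/-- The change s = t₀ - t and v' ⊥ w turn the distance to the scattering point into √(s² + ε²),
which isolates the one-dimensional singular kernel. -/
theorem alphaOne_eq_integral_nearRayDensity {x' v' w : Space n} (hv : ‖v'‖ = 1) (hw : ‖w‖ = 1)
    (hvw : ⟪v', w⟫ = 0) (hν : ⟪outwardNormal X x', v'⟫ ≠ 0) (t₀ ε : ℝ) :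
    alphaOne X σ k (x' + t₀ • v' + ε • w) x' v' /
      (attenuation σ (x' + t₀ • v') x' * |⟪outwardNormal X x', v'⟫|) =
      ∫ s, nearRayDensity X σ k x' v' w t₀ ε s / √(s ^ 2 + ε ^ 2) ^ (n - 1) := by
  have hν' : |⟪outwardNormal X x', v'⟫| ≠ 0 := abs_ne_zero.2 hν
  have hE := (attenuation_pos (σ := σ) (x' + t₀ • v') x').ne'
  set τ := tauPlus X x' v' with hτ
  have hτ0 : 0 ≤ τ := tauPlus_nonneg _ _
  have h1 : alphaOne X σ k (x' + t₀ • v' + ε • w) x' v' /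
      (attenuation σ (x' + t₀ • v') x' * |⟪outwardNormal X x', v'⟫|) =
      ∫ t in (0 : ℝ)..τ, kernelDensity σ k (x' + t₀ • v' + ε • w) x' v' t /
        attenuation σ (x' + t₀ • v') x' := by
    rw [intervalIntegral.integral_div, mul_comm (attenuation σ (x' + t₀ • v') x'), ← div_div]
    congr 1
    exact mul_div_cancel_left₀ _ hν'
  have h2 := intervalIntegral.integral_comp_sub_left (a := t₀ - τ) (b := t₀)
    (fun t : ℝ => kernelDensity σ k (x' + t₀ • v' + ε • w) x' v' t /
        attenuation σ (x' + t₀ • v') x') t₀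
  rw [sub_self, sub_sub_cancel] at h2
  rw [h1, ← h2, intervalIntegral.integral_of_le (by linarith), integral_Ioc_eq_integral_Ioo,
    ← integral_indicator measurableSet_Ioo]
  refine integral_congr_ae (Eventually.of_forall fun s => ?_)
  beta_reduce
  by_cases hs : s ∈ Ioo (t₀ - τ) t₀
  · have hy : x' + (t₀ - s) • v' = x' + t₀ • v' - s • v' := by rw [sub_smul]; abel
    have hn : ‖x' + t₀ • v' + ε • w - x' - (t₀ - s) • v'‖ = √(s ^ 2 + ε ^ 2) := by
      rw [← norm_offset hv hw hvw, sub_smul]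
      congr 1
      abel
    rw [indicator_of_mem hs, nearRayDensity, indicator_of_mem hs, kernelDensity, hy, hn]
    ring
  · rw [indicator_of_notMem hs, nearRayDensity, indicator_of_notMem hs, zero_div]

theorem eventually_offset_mem (hXo : IsOpen X) {x w : Space n} (hx : x ∈ X) :
    ∀ᶠ ε in 𝓝[>] (0 : ℝ), x + ε • w ∈ X := by
  have hc : Continuous (fun t : ℝ => x + t • w) := by fun_prop
  have h := (hc.tendsto 0).mono_left (nhdsWithin_le_nhds (s := Ioi 0))
  simp only [zero_smul, add_zero] at h
  exact h.eventually (hXo.mem_nhds hx)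

theorem exists_bound_nearRayDensity (hXo : IsOpen X) (hXb : Bornology.IsBounded X)
    (hXc : Convex ℝ X) {M N : ℝ} (hσM : ∀ x v, |σ x v| ≤ M) (hkN : ∀ x v w, |k x v w| ≤ N)
    {x' v' : Space n} (hx' : x' ∈ frontier X) (hv : ‖v'‖ = 1) (w : Space n) {t₀ : ℝ}
    (hx : x' + t₀ • v' ∈ X) :
    ∃ C, ∀ᶠ ε in 𝓝[>] (0 : ℝ), ∀ s, |nearRayDensity X σ k x' v' w t₀ ε s| ≤ C := by
  have hM : 0 ≤ M := (abs_nonneg _).trans (hσM 0 0)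
  have hN : 0 ≤ N := (abs_nonneg _).trans (hkN 0 0 0)
  have h0 : 0 ≤ M + N * (sphereMeasure n).real univ := by positivity
  obtain ⟨D, hD⟩ : ∃ D, ∀ y ∈ closure X, ∀ z ∈ closure X, ‖y - z‖ ≤ D :=
    ⟨diam (closure X), fun y hy z hz => by
      rw [← dist_eq_norm]; exact dist_le_diam_of_mem hXb.closure hy hz⟩
  have hatt : ∀ y ∈ closure X, ∀ z ∈ closure X, attenuation σ y z ≤ Real.exp (M * D) :=
    fun y hy z hz => (attenuation_le hσM y z).trans
      (Real.exp_le_exp.2 (mul_le_mul_of_nonneg_left (hD y hy z hz) hM))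
  set e := Real.exp (M * D) with he
  have he0 : 0 < e := Real.exp_pos _
  have hE := attenuation_pos (σ := σ) (x' + t₀ • v') x'
  refine ⟨(M + N * (sphereMeasure n).real univ) * (e * e) * N /
    attenuation σ (x' + t₀ • v') x', ?_⟩
  filter_upwards [eventually_offset_mem hXo (w := w) hx] with ε hε s
  by_cases hs : s ∈ Ioo (t₀ - tauPlus X x' v') t₀
  · have hmem : x' + t₀ • v' - s • v' ∈ X := by
      rw [add_sub_assoc, ← sub_smul, add_smul_mem_iff hXo hXb hXc (frontier_subset_closure hx') hv
        (by linarith [hs.2])]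
      linarith [hs.1]
    rw [nearRayDensity, indicator_of_mem hs, abs_div, abs_of_pos hE, abs_mul, abs_mul, abs_mul,
      abs_of_pos (attenuation_pos _ _), abs_of_pos (attenuation_pos _ _)]
    refine div_le_div_of_nonneg_right ?_ hE.le
    refine mul_le_mul (mul_le_mul (abs_sigmaA_le hσM hkN _ _) (mul_le_mul ?_ ?_
      (attenuation_pos _ _).le he0.le) (mul_pos (attenuation_pos _ _) (attenuation_pos _ _)).le h0)
      (hkN _ _ _) (abs_nonneg _) (mul_nonneg h0 (mul_pos he0 he0).le)
    · exact hatt _ (subset_closure hε) _ (subset_closure hmem)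
    · exact hatt _ (subset_closure hmem) _ (frontier_subset_closure hx')
  · rw [nearRayDensity, indicator_of_notMem hs, abs_zero]
    positivity

/-- The scattering point and x + εw both tend to x, so the attenuation between them tends to 1 and
the other cancels the normalisation. Only the limiting direction d depends on the path s(ε), which
lets one statement serve both scalings. -/
theorem tendsto_nearRayDensity (hXo : IsOpen X) (hXb : Bornology.IsBounded X) (hXc : Convex ℝ X)
    (hσ : Measurable fun p : Space n × Space n => σ p.1 p.2)
    (hk : Measurable fun p : Space n × Space n × Space n => k p.1 p.2.1 p.2.2) {M N : ℝ}
    (hσM : ∀ x v, |σ x v| ≤ M) (hkN : ∀ x v w, |k x v w| ≤ N)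
    (hσc : ContinuousOn (fun p : Space n × Space n => σ p.1 p.2) (X ×ˢ sphere (0 : Space n) 1))
    (hkc : ContinuousOn (fun p : Space n × Space n × Space n => k p.1 p.2.1 p.2.2)
      (X ×ˢ sphere (0 : Space n) 1 ×ˢ sphere (0 : Space n) 1))
    {x' v' w : Space n} (hx' : x' ∈ frontier X) (hv : ‖v'‖ = 1) (hw : ‖w‖ = 1)
    (hvw : ⟪v', w⟫ = 0) {t₀ : ℝ} (ht₀ : t₀ ∈ Ioo 0 (tauPlus X x' v')) {s : ℝ → ℝ}
    (hs : Tendsto s (𝓝[>] 0) (𝓝 0)) {d : Space n} (hd : ‖d‖ = 1)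
    (hlim : Tendsto (fun ε => ‖s ε • v' + ε • w‖⁻¹ • (s ε • v' + ε • w)) (𝓝[>] 0) (𝓝 d)) :
    Tendsto (fun ε => nearRayDensity X σ k x' v' w t₀ ε (s ε)) (𝓝[>] 0)
      (𝓝 (chi σ k (x' + t₀ • v') v' d)) := by
  set x := x' + t₀ • v' with hxdef
  have hx : x ∈ X := (add_smul_mem_iff hXo hXb hXc (frontier_subset_closure hx') hv ht₀.1).2 ht₀.2
  have hE := (attenuation_pos (σ := σ) x x').ne'
  have hε : Tendsto (fun ε : ℝ => ε) (𝓝[>] 0) (𝓝 0) := nhdsWithin_le_nhds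
  have hxε : Tendsto (fun ε : ℝ => x + ε • w) (𝓝[>] 0) (𝓝 x) := by
    simpa using (hε.smul_const w).const_add x
  have hy : Tendsto (fun ε : ℝ => x - s ε • v') (𝓝[>] 0) (𝓝 x) := by
    simpa using (hs.smul_const v').const_sub x
  have hyX : ∀ᶠ ε in 𝓝[>] (0 : ℝ), x - s ε • v' ∈ X := hy.eventually (hXo.mem_nhds hx)
  have hdir : Tendsto (fun ε => direction (x + ε • w) (x - s ε • v')) (𝓝[>] 0) (𝓝 d) := by
    simpa only [direction_offset] using hlim
  have hunit : ∀ᶠ ε in 𝓝[>] (0 : ℝ), ‖direction (x + ε • w) (x - s ε • v')‖ = 1 := by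
    filter_upwards [self_mem_nhdsWithin] with ε hε
    have hε : 0 < ε := hε
    refine norm_direction fun heq => ?_
    have h0 : s ε • v' + ε • w = 0 := by
      rw [show s ε • v' + ε • w = x + ε • w - (x - s ε • v') by abel, heq, sub_self]
    have h1 := norm_offset hv hw hvw ε (s ε)
    rw [h0, norm_zero, eq_comm, Real.sqrt_eq_zero (by positivity)] at h1
    nlinarith [sq_nonneg (s ε)]
  have hA : Tendsto (fun ε => sigmaA σ k (x + ε • w) (direction (x + ε • w) (x - s ε • v')))
      (𝓝[>] 0) (𝓝 (sigmaA σ k x d)) := by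
    have hc := continuousOn_sigmaA hk hkN hσc hkc (x, d) ⟨hx, by simpa using hd⟩
    refine Tendsto.comp (f := fun ε : ℝ => (x + ε • w, direction (x + ε • w) (x - s ε • v'))) hc
      (tendsto_nhdsWithin_iff.2 ⟨hxε.prodMk_nhds hdir, ?_⟩)
    filter_upwards [eventually_offset_mem hXo (w := w) hx, hunit] with ε h1 h2
    exact ⟨h1, by simpa using h2⟩
  have hK : Tendsto (fun ε => k (x - s ε • v') v' (direction (x + ε • w) (x - s ε • v')))
      (𝓝[>] 0) (𝓝 (k x v' d)) := by
    have hc := hkc (x, v', d) ⟨hx, by simpa using hv, by simpa using hd⟩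
    refine Tendsto.comp (f := fun ε : ℝ => (x - s ε • v', v',
      direction (x + ε • w) (x - s ε • v'))) hc
      (tendsto_nhdsWithin_iff.2 ⟨hy.prodMk_nhds (tendsto_const_nhds.prodMk_nhds hdir), ?_⟩)
    filter_upwards [hyX, hunit] with ε h1 h2
    exact ⟨h1, by simpa using hv, by simpa using h2⟩
  have hatt1 : Tendsto (fun ε => attenuation σ (x + ε • w) (x - s ε • v')) (𝓝[>] 0) (𝓝 1) := by
    refine tendsto_attenuation_one hσM ?_
    simpa using (hxε.sub hy).norm
  have hatt2 : Tendsto (fun ε => attenuation σ (x - s ε • v') x') (𝓝[>] 0)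
      (𝓝 (attenuation σ x x')) := by
    have h1 : Tendsto (fun ε => t₀ - s ε) (𝓝[>] 0) (𝓝 t₀) := by simpa using hs.const_sub t₀
    have h2 := tendsto_attenuation_along_ray hσ hσM (x := x') hv ht₀.1 h1
    refine h2.congr fun ε => ?_
    rw [sub_smul, ← add_sub_assoc]
  have hprod := ((hA.mul (hatt1.mul hatt2)).mul hK).div_const (attenuation σ x x')
  have hval : sigmaA σ k x d * (1 * attenuation σ x x') * k x v' d / attenuation σ x x' =
      chi σ k x v' d := by
    rw [chi]; field_simp
  rw [hval] at hprod
  refine hprod.congr' ?_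
  have hsI : ∀ᶠ ε in 𝓝[>] (0 : ℝ), s ε ∈ Ioo (t₀ - tauPlus X x' v') t₀ :=
    hs.eventually (Ioo_mem_nhds (by linarith [ht₀.2]) ht₀.1)
  filter_upwards [hsI] with ε hε
  rw [nearRayDensity, indicator_of_mem hε]

end NearRay

end Photoacoustic

namespace Photoacoustic

/-! ### Asymptotics of α₁ near the incoming ray -/

section Asymptotics

variable {n : ℕ} {X : Set (Space n)} {σ : Space n → Space n → ℝ}
  {k : Space n → Space n → Space n → ℝ}

theorem norm_cos_smul_add_sin_smul {v w : Space n} (hv : ‖v‖ = 1) (hw : ‖w‖ = 1)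
    (hvw : ⟪v, w⟫ = 0) (θ : ℝ) : ‖Real.cos θ • v + Real.sin θ • w‖ = 1 := by
  rw [norm_offset hv hw hvw, Real.cos_sq_add_sin_sq, Real.sqrt_one]

/-- Here ε is negligible against ε^r; with d = ±v' this explains why only forward and backward
scattering appear in dimension two. -/
theorem tendsto_direction_small_perturbation {d : Space n} (hd : ‖d‖ = 1) (w : Space n)
    {r : ℝ} (hr : r < 1) :
    Tendsto (fun ε => ‖Real.exp (r * Real.log ε) • d + ε • w‖⁻¹ •
      (Real.exp (r * Real.log ε) • d + ε • w)) (𝓝[>] 0) (𝓝 d) := by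
  have h0 := tendsto_exp_mul_log (sub_pos.2 hr)
  have h1 : Tendsto (fun ε => d + Real.exp ((1 - r) * Real.log ε) • w) (𝓝[>] 0) (𝓝 d) := by
    simpa using (h0.smul_const w).const_add d
  have h2 := (h1.norm.inv₀ (by rw [hd]; exact one_ne_zero)).smul h1
  rw [hd, inv_one, one_smul] at h2
  refine h2.congr' ?_
  filter_upwards [self_mem_nhdsWithin] with ε hε
  have hε : 0 < ε := hε
  rw [← normalize_smul (Real.exp_pos (r * Real.log ε)), smul_add, smul_smul, ← Real.exp_add,
    show r * Real.log ε + (1 - r) * Real.log ε = Real.log ε by ring, Real.exp_log hε]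

variable (hXo : IsOpen X) (hXb : Bornology.IsBounded X) (hXc : Convex ℝ X)
    (hσ : Measurable fun p : Space n × Space n => σ p.1 p.2)
    (hk : Measurable fun p : Space n × Space n × Space n => k p.1 p.2.1 p.2.2) {M N : ℝ}
    (hσM : ∀ x v, |σ x v| ≤ M) (hkN : ∀ x v w, |k x v w| ≤ N)
    (hσc : ContinuousOn (fun p : Space n × Space n => σ p.1 p.2) (X ×ˢ sphere (0 : Space n) 1))
    (hkc : ContinuousOn (fun p : Space n × Space n × Space n => k p.1 p.2.1 p.2.2)
      (X ×ˢ sphere (0 : Space n) 1 ×ˢ sphere (0 : Space n) 1))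
    {x' v' w : Space n} (hxv : (x', v') ∈ incoming X) (hw : ‖w‖ = 1)
    (hvw : ⟪v', w⟫ = 0) {t₀ : ℝ} (ht₀ : t₀ ∈ Ioo 0 (tauPlus X x' v'))

include hXo hXb hXc hσ hk hσM hkN hσc hkc hxv hw hvw ht₀

theorem tendsto_log_inv_mul_alphaOne (hn : n = 2) :
    Tendsto (fun ε => (Real.log (1 / ε))⁻¹ * (alphaOne X σ k (x' + t₀ • v' + ε • w) x' v' /
        (attenuation σ (x' + t₀ • v') x' * |⟪outwardNormal X x', v'⟫|))) (𝓝[>] 0)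
      (𝓝 (chi σ k (x' + t₀ • v') v' v' + chi σ k (x' + t₀ • v') v' (-v'))) := by
  have hv : ‖v'‖ = 1 := by simpa using hxv.2.1
  have hx := (add_smul_mem_iff hXo hXb hXc (frontier_subset_closure hxv.1) hv ht₀.1).2 ht₀.2
  obtain ⟨C, hC⟩ := exists_bound_nearRayDensity hXo hXb hXc hσM hkN hxv.1 hv w hx
  simp only [alphaOne_eq_integral_nearRayDensity hv hw hvw hxv.2.2.ne, hn, Nat.add_one_sub_one,
    pow_one]
  refine tendsto_integral_div_sqrt (ht₀.1.trans ht₀.2)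
    (Eventually.of_forall fun ε => measurable_nearRayDensity hσ hk x' v' w t₀ ε) hC
    (fun ε s hs => ?_) (fun r hr => ?_) fun r hr => ?_
  · rw [nearRayDensity, indicator_of_notMem]
    rintro ⟨h1, h2⟩
    refine hs.not_ge (abs_le.2 ⟨?_, ?_⟩) <;> linarith [ht₀.1, ht₀.2]
  · exact tendsto_nearRayDensity hXo hXb hXc hσ hk hσM hkN hσc hkc hxv.1 hv hw hvw ht₀
      (tendsto_exp_mul_log hr.1) hv (tendsto_direction_small_perturbation hv w hr.2)
  · refine tendsto_nearRayDensity hXo hXb hXc hσ hk hσM hkN hσc hkc hxv.1 hv hw hvw ht₀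
      (by simpa using (tendsto_exp_mul_log hr.1).neg) (by rwa [norm_neg]) ?_
    simpa only [smul_neg, neg_smul] using
      tendsto_direction_small_perturbation (d := -v') (by rwa [norm_neg]) w hr.2

/-- Concentration with m = n - 1. Along s = ε cot θ the direction is exactly cos θ v' + sin θ w for
every ε > 0, not merely in the limit. -/
theorem tendsto_pow_mul_alphaOne (hn : 3 ≤ n) :
    Tendsto (fun ε => ε ^ (n - 2) * (alphaOne X σ k (x' + t₀ • v' + ε • w) x' v' /
        (attenuation σ (x' + t₀ • v') x' * |⟪outwardNormal X x', v'⟫|))) (𝓝[>] 0)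
      (𝓝 (∫ θ in (0 : ℝ)..Real.pi, Real.sin θ ^ (n - 3) *
        chi σ k (x' + t₀ • v') v' (Real.cos θ • v' + Real.sin θ • w))) := by
  have hv : ‖v'‖ = 1 := by simpa using hxv.2.1
  have hx := (add_smul_mem_iff hXo hXb hXc (frontier_subset_closure hxv.1) hv ht₀.1).2 ht₀.2
  obtain ⟨C, hC⟩ := exists_bound_nearRayDensity hXo hXb hXc hσM hkN hxv.1 hv w hx
  simp only [alphaOne_eq_integral_nearRayDensity hv hw hvw hxv.2.2.ne]
  refine tendsto_integral_div_sqrt_pow (m := n - 1) (by omega)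
    (Eventually.of_forall fun ε => measurable_nearRayDensity hσ hk x' v' w t₀ ε) hC
    fun θ hθ => ?_
  have hsin := Real.sin_pos_of_mem_Ioo hθ
  have hε : Tendsto (fun ε : ℝ => ε) (𝓝[>] 0) (𝓝 0) := nhdsWithin_le_nhds
  have hz := norm_cos_smul_add_sin_smul hv hw hvw θ
  refine tendsto_nearRayDensity hXo hXb hXc hσ hk hσM hkN hσc hkc hxv.1 hv hw hvw ht₀
    (by simpa using hε.mul_const (Real.cos θ / Real.sin θ)) hz ?_
  refine tendsto_const_nhds.congr' ?_
  filter_upwards [self_mem_nhdsWithin] with ε hε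
  have hε : 0 < ε := hε
  have h := normalize_smul (div_pos hε hsin) (Real.cos θ • v' + Real.sin θ • w)
  rw [hz, inv_one, one_smul, smul_add, smul_smul, smul_smul, div_mul_cancel₀ _ hsin.ne',
    div_mul_eq_mul_div, ← mul_div_assoc'] at h
  exact h.symm

end Asymptotics

theorem isLittleO_sub_mul_of_tendsto {l : Filter ℝ} {f L : ℝ → ℝ} {c : ℝ}
    (hL : ∀ᶠ ε in l, L ε ≠ 0) (h : Tendsto (fun ε => (L ε)⁻¹ * f ε) l (𝓝 c)) :
    (fun ε => f ε - L ε * c) =o[l] L := by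
  rw [isLittleO_iff_tendsto' (hL.mono fun ε h0 h1 => absurd h1 h0)]
  have h1 := h.sub_const c
  rw [sub_self] at h1
  refine h1.congr' (hL.mono fun ε h0 => ?_)
  field_simp

end Photoacoustic

open Photoacoustic

theorem theorem2p2 {n : ℕ} (hn : 2 ≤ n) (X : Set (Space n))
    (hXopen : IsOpen X) (hXbdd : Bornology.IsBounded X) (hXconvex : Convex ℝ X)
    (hXC1 : HasC1Boundary X)
    (σ : Space n → Space n → ℝ) (k : Space n → Space n → Space n → ℝ)
    (hσ : BoundedContinuousOn (fun p : Space n × Space n => σ p.1 p.2)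
      (X ×ˢ sphere (0 : Space n) 1))
    (hk : BoundedContinuousOn (fun p : Space n × Space n × Space n => k p.1 p.2.1 p.2.2)
      (X ×ˢ sphere (0 : Space n) 1 ×ˢ sphere (0 : Space n) 1)) :
    -- `α₁` is the Schwartz kernel of the single scattering operator `A₁`
    IsSchwartzKernel X (albedoOne X σ k) (alphaOne X σ k) ∧
    -- and it has the stated asymptotics near the incoming ray
    ∀ x' v' : Space n, (x', v') ∈ incoming X →
      ∀ t₀ ∈ Ioo (0 : ℝ) (tauPlus X x' v'), ∀ x : Space n, x = x' + t₀ • v' →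
        ∀ vperp ∈ sphere (0 : Space n) 1, ⟪v', vperp⟫ = 0 →
          (n = 2 →
            (fun ε : ℝ =>
              alphaOne X σ k (x + ε • vperp) x' v' /
                  (attenuation σ x x' * |⟪outwardNormal X x', v'⟫|) -
                Real.log (1 / ε) * (chi σ k x v' v' + chi σ k x v' (-v')))
              =o[𝓝[>] 0] fun ε : ℝ => Real.log (1 / ε)) ∧
          (3 ≤ n →
            (fun ε : ℝ =>
              alphaOne X σ k (x + ε • vperp) x' v' /
                  (attenuation σ x x' * |⟪outwardNormal X x', v'⟫|) -
                1 / ε ^ (n - 2) * ∫ θ in (0 : ℝ)..Real.pi, Real.sin θ ^ (n - 3) *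
                  chi σ k x v' (Real.cos θ • v' + Real.sin θ • vperp))
              =o[𝓝[>] 0] fun ε : ℝ => 1 / ε ^ (n - 2)) := by
  -- The hypotheses constrain the coefficients only on X and unit directions; the integrals are
  -- studied for bounded measurable extensions and the results are carried back.
  have hS : MeasurableSet (sphere (0 : Space n) 1) := isClosed_sphere.measurableSet
  obtain ⟨s, hsm, ⟨M, hM⟩, hsE⟩ := exists_measurable_extension (hXopen.measurableSet.prod hS) hσ
  obtain ⟨c, hcm, ⟨N, hN⟩, hcE⟩ :=
    exists_measurable_extension (hXopen.measurableSet.prod (hS.prod hS)) hk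
  have hσ' : ∀ x ∈ X, ∀ v, ‖v‖ = 1 → σ x v = (fun x v => s (x, v)) x v := fun x hx v hv =>
    hsE (x := (x, v)) ⟨hx, by simpa using hv⟩
  have hk' : ∀ x ∈ X, ∀ v w, ‖v‖ = 1 → ‖w‖ = 1 → k x v w = (fun x v w => c (x, v, w)) x v w :=
    fun x hx v w hv hw => hcE (x := (x, v, w)) ⟨hx, by simpa using hv, by simpa using hw⟩
  have hsc := hσ.1.congr fun p hp => (hsE hp).symm
  have hcc := hk.1.congr fun p hp => (hcE hp).symm
  refine ⟨isSchwartzKernel_congr hn hXopen hXbdd hXconvex hXC1 hσ' hk'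
    (isSchwartzKernel_of_measurable hn hXopen hXbdd hXconvex hXC1 hsm hcm
      (fun x v => hM (x, v)) fun x v w => hN (x, v, w)), ?_⟩
  rintro x' v' hxv t₀ ht₀ x rfl w hw hvw
  have hw : ‖w‖ = 1 := by simpa using hw
  have hv : ‖v'‖ = 1 := by simpa using hxv.2.1
  have hx := (add_smul_mem_iff hXopen hXbdd hXconvex (frontier_subset_closure hxv.1) hv ht₀.1).2
    ht₀.2
  have hchi : ∀ d, ‖d‖ = 1 → chi σ k (x' + t₀ • v') v' d =
      chi (fun x v => s (x, v)) (fun x v w => c (x, v, w)) (x' + t₀ • v') v' d := fun d hd => by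
    rw [chi, chi, sigmaA_congr hσ' hk' hx hd, hk' _ hx v' d hv hd]
  -- Exchanging the coefficients in α₁ requires x + εw ∈ X, which holds only for small ε; this
  -- suffices for the limit.
  have hquot : ∀ᶠ ε in 𝓝[>] (0 : ℝ),
      alphaOne X (fun x v => s (x, v)) (fun x v w => c (x, v, w)) (x' + t₀ • v' + ε • w) x' v' /
        (attenuation (fun x v => s (x, v)) (x' + t₀ • v') x' * |⟪outwardNormal X x', v'⟫|) =
      alphaOne X σ k (x' + t₀ • v' + ε • w) x' v' /
        (attenuation σ (x' + t₀ • v') x' * |⟪outwardNormal X x', v'⟫|) := by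
    filter_upwards [eventually_offset_mem hXopen (w := w) hx] with ε hε
    rw [alphaOne_congr hn hXopen hXbdd hXconvex hσ' hk' hε hxv,
      attenuation_congr_incoming hXopen hXbdd hXconvex hσ' hxv.1 hv ht₀]
  refine ⟨fun h2 => ?_, fun h3 => ?_⟩
  · have h := tendsto_log_inv_mul_alphaOne hXopen hXbdd hXconvex (σ := fun x v => s (x, v))
      (k := fun x v w => c (x, v, w)) hsm hcm (fun x v => hM (x, v)) (fun x v w => hN (x, v, w))
      hsc hcc hxv hw hvw ht₀ h2
    rw [hchi v' hv, hchi (-v') (by rwa [norm_neg])]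
    refine isLittleO_sub_mul_of_tendsto ?_ (h.congr' (hquot.mono fun ε hε => by rw [hε]))
    -- Restricting to ε < 1 keeps the comparison function log(1/ε) from vanishing.
    filter_upwards [Ioo_mem_nhdsGT one_pos] with ε hε
    exact (Real.log_pos ((one_lt_div hε.1).2 hε.2)).ne'
  · have h := tendsto_pow_mul_alphaOne hXopen hXbdd hXconvex (σ := fun x v => s (x, v))
      (k := fun x v w => c (x, v, w)) hsm hcm (fun x v => hM (x, v)) (fun x v w => hN (x, v, w))
      hsc hcc hxv hw hvw ht₀ h3
    simp only [hchi _ (norm_cos_smul_add_sin_smul hv hw hvw _)]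
    refine isLittleO_sub_mul_of_tendsto ?_
      (h.congr' (hquot.mono fun ε hε => by beta_reduce; rw [hε, one_div, inv_inv]))
    filter_upwards [self_mem_nhdsWithin] with ε hε
    have hε : 0 < ε := hε
    positivity
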